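/- Conventions. A virtual link diagram $D=D_1\cup\dots\cup D_n$ is a diagram of $n$ oriented closed curves with classical and virtual crossings. It is regarded up to the virtual Reidemeister moves, i.e. it is given by its Gauss diagram: $n$ oriented circles with finitely many signed arrows with pairwise distinct end points, one arrow for each classical crossing $c$, directed from the over crossing point to the under crossing point and carrying the sign $\operatorname{sgn}(c)$. Two diagrams are equivalent if they are related by isotopies (orientation preserving reparametrizations of the circles and renumbering of the components) and the Reidemeister moves RI, RII, RIII of Gauss diagrams; a virtual link $L$ is an equivalence class of diagrams, and it is trivial if it has a diagram without classical crossings. Virtualizing a classical crossing deletes its arrow; a crossing change reverses its arrow and its sign. A diagram $D$ is $(m,k)$-unknottable if virtualizing $m$ of its classical crossings and changing $k$ others gives a diagram of the trivial link. $U(D)$ is the minimum in dictionary order of the pairs $(m,k)$ for which $D$ is $(m,k)$-unknottable, and $U(L)$ is the minimum of $U(D)$ over all diagrams $D$ of $L$. For $i\ne j$ let $\operatorname{span}(D_i\cup D_j)=|r_+-r_--\ell_++\ell_-|$, where $r_\pm$ (respectively $\ell_\pm$) is the number of crossings of sign $\pm1$ at which $D_i$ passes over (respectively under) $D_j$; let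 $\operatorname{span}(D)=\sum_{i<j}\operatorname{span}(D_i\cup D_j)$, and let $\operatorname{lk}(D)$ be half the sum of the signs of all classical crossings between different components. For a set $S$ of classical crossings of $D$ let $D_S$ be the diagram obtained by virtualizing the crossings in $S$, let $\Lambda(D)=\{S : |S|=\operatorname{span}(D),\ \operatorname{span}(D_S)=0\}$ (which is never empty), and let $\ell_D=\min\{|\operatorname{lk}(D_S)| : S\in\Lambda(D)\}$. For a crossing $c$ of a virtual knot diagram $K$, $\operatorname{Ind}(c)=r_+-r_--l_++l_-$, where $r_\pm$ (respectively $l_\pm$) is the number of chords of sign $\pm 1$ of the Gauss diagram of $K$ that cross the chord of $c$ from right to left (respectively from left to right), and $J_k(K)=\sum_{\operatorname{Ind}(c)=k}\operatorname{sgn}(c)$ for $k\in\mathbb Z\setminus\{0\}$. Theorem. If $D=D_1\cup D_2\cup\dots\cup D_n$ is a diagram of a virtual link $L$, then, in dictionary order, $$\Big(\operatorname{span}(D),\ \sum_{1\le i<j\le n}\ell_{D_i\cup D_j}+\tfrac12\sum_{i=1}^n\ \sum_{k\in\mathbb Z\setminus\{0\}}|J_k(D_i)|\Big)\ \le\ U(L).$$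 -/

import Mathlib

/-!
Virtual links are treated through their Gauss diagrams: a virtual link diagram up to the virtual
moves (VRI, VRII, VRIII, SV) is the same thing as its Gauss diagram, and a virtual link is
a Gauss diagram up to isotopy and the classical moves RI, RII, RIII.  Virtual crossings do not
appear in a Gauss diagram, so that virtualizing a crossing is deleting its arrow.
-/

/-- A family of oriented circles `ℝ / ℤ`, one for each `i : ι`: the points of their union. -/
abbrev CirclePoint (ι : Type) : Type := ι × AddCircle (1 : ℝ)

/-- A classical crossing as seen in a Gauss diagram: an arrow directed from the over crossing point
(`tail`) to the under crossing point (`head`), with the sign of the crossing. -/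
@[ext]
structure SignedArrow (ι : Type) where
  tail : CirclePoint ι
  head : CirclePoint ι
  sign : ℤˣ

namespace SignedArrow

variable {ι κ : Type}

noncomputable instance : DecidableEq (SignedArrow ι) := Classical.decEq _

/-- Transport of an arrow along a map of points. -/
def map (f : CirclePoint ι → CirclePoint κ) (a : SignedArrow ι) : SignedArrow κ :=
  ⟨f a.tail, f a.head, a.sign⟩

/-- Crossing change: over and under are exchanged, and the sign is reversed. -/
def flip (a : SignedArrow ι) : SignedArrow ι := ⟨a.head, a.tail, -a.sign⟩

theorem map_injective {f : CirclePoint ι → CirclePoint κ} (hf : Function.Injective f) :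
    Function.Injective (map f) := by
  intro a b h
  have h1 := congrArg SignedArrow.tail h
  have h2 := congrArg SignedArrow.head h
  have h3 := congrArg SignedArrow.sign h
  exact SignedArrow.ext (hf h1) (hf h2) h3

end SignedArrow

/-- A Gauss diagram on circles indexed by `ι` (`ι = Fin n` for an `n`-component link): finitely many
signed arrows, all of whose end points are pairwise distinct. -/
@[ext]
structure GaussDiagram (ι : Type) where
  arrows : Finset (SignedArrow ι)
  tail_inj : ∀ a ∈ arrows, ∀ b ∈ arrows, a.tail = b.tail → a = b
  head_inj : ∀ a ∈ arrows, ∀ b ∈ arrows, a.head = b.head → a = b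
  tail_ne_head : ∀ a ∈ arrows, ∀ b ∈ arrows, a.tail ≠ b.head

namespace GaussDiagram

variable {ι : Type}

/-- The diagram without classical crossings: the trivial link. -/
def unlink (ι : Type) : GaussDiagram ι where
  arrows := ∅
  tail_inj := by simp
  head_inj := by simp
  tail_ne_head := by simp

/-- `D.virtualize S` is the diagram obtained from `D` by virtualizing the crossings in `S`. -/
noncomputable def virtualize (D : GaussDiagram ι) (S : Finset (SignedArrow ι)) :
    GaussDiagram ι where
  arrows := D.arrows \ S
  tail_inj a ha b hb := D.tail_inj a (Finset.mem_sdiff.1 ha).1 b (Finset.mem_sdiff.1 hb).1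
  head_inj a ha b hb := D.head_inj a (Finset.mem_sdiff.1 ha).1 b (Finset.mem_sdiff.1 hb).1
  tail_ne_head a ha b hb := D.tail_ne_head a (Finset.mem_sdiff.1 ha).1 b (Finset.mem_sdiff.1 hb).1

/-- `D.changeCrossings T` is obtained from `D` by changing those crossings that belong to `T`. -/
noncomputable def changeCrossings (D : GaussDiagram ι) (T : Finset (SignedArrow ι)) :
    GaussDiagram ι where
  arrows := D.arrows.image (fun a => if a ∈ T then a.flip else a)
  tail_inj := by
    intro a ha b hb h
    obtain ⟨x, hx, rfl⟩ := Finset.mem_image.1 ha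
    obtain ⟨y, hy, rfl⟩ := Finset.mem_image.1 hb
    have key : x = y := by
      by_cases h1 : x ∈ T <;> by_cases h2 : y ∈ T <;>
        simp only [h1, h2, if_true, if_false, SignedArrow.flip] at h
      · exact D.head_inj x hx y hy h
      · exact absurd h.symm (D.tail_ne_head y hy x hx)
      · exact absurd h (D.tail_ne_head x hx y hy)
      · exact D.tail_inj x hx y hy h
    rw [key]
  head_inj := by
    intro a ha b hb h
    obtain ⟨x, hx, rfl⟩ := Finset.mem_image.1 ha
    obtain ⟨y, hy, rfl⟩ := Finset.mem_image.1 hb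
    have key : x = y := by
      by_cases h1 : x ∈ T <;> by_cases h2 : y ∈ T <;>
        simp only [h1, h2, if_true, if_false, SignedArrow.flip] at h
      · exact D.tail_inj x hx y hy h
      · exact absurd h (D.tail_ne_head x hx y hy)
      · exact absurd h.symm (D.tail_ne_head y hy x hx)
      · exact D.head_inj x hx y hy h
    rw [key]
  tail_ne_head := by
    intro a ha b hb h
    obtain ⟨x, hx, rfl⟩ := Finset.mem_image.1 ha
    obtain ⟨y, hy, rfl⟩ := Finset.mem_image.1 hb
    by_cases h1 : x ∈ T <;> by_cases h2 : y ∈ T <;>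
      simp only [h1, h2, if_true, if_false, SignedArrow.flip] at h
    · exact D.tail_ne_head y hy x hx h.symm
    · have e := D.head_inj x hx y hy h
      rw [e] at h1
      exact h2 h1
    · have e := D.tail_inj x hx y hy h
      rw [e] at h1
      exact h1 h2
    · exact D.tail_ne_head x hx y hy h

/-- The subdiagram formed by the components in `s`: only those circles, and only the crossings among
them, are kept.  Thus `D.sublink {i}` is the component `D_i`, a virtual knot diagram, and
`D.sublink {i, j}` is `D_i ∪ D_j`. -/
noncomputable def sublink (D : GaussDiagram ι) (s : Finset ι) : GaussDiagram s where
  arrows := D.arrows.preimage (SignedArrow.map (Prod.map Subtype.val id))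
    (SignedArrow.map_injective
      (Function.Injective.prodMap Subtype.val_injective Function.injective_id)).injOn
  tail_inj _ ha _ hb h :=
    SignedArrow.map_injective
      (Function.Injective.prodMap Subtype.val_injective Function.injective_id)
      (D.tail_inj _ (Finset.mem_preimage.1 ha) _ (Finset.mem_preimage.1 hb)
        (congrArg (Prod.map Subtype.val id) h))
  head_inj _ ha _ hb h :=
    SignedArrow.map_injective
      (Function.Injective.prodMap Subtype.val_injective Function.injective_id)
      (D.head_inj _ (Finset.mem_preimage.1 ha) _ (Finset.mem_preimage.1 hb)
        (congrArg (Prod.map Subtype.val id) h))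
  tail_ne_head _ ha _ hb h :=
    D.tail_ne_head _ (Finset.mem_preimage.1 ha) _ (Finset.mem_preimage.1 hb)
      (congrArg (Prod.map Subtype.val id) h)

/-! ### Equivalence of diagrams -/

/-- `p` and `q` are distinct points of the same circle, and no end point of an arrow of `D` lies on
the open arc that runs from `p` to `q` along the orientation. -/
def EmptyArc (D : GaussDiagram ι) (p q : CirclePoint ι) : Prop :=
  p.1 = q.1 ∧ p.2 ≠ q.2 ∧ ∀ a ∈ D.arrows, ∀ x : CirclePoint ι, (x = a.tail ∨ x = a.head) →
    x.1 = p.1 → ¬ sbtw p.2 x.2 q.2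

/-- `p` and `q` are neighbours on a circle of `D`, joined by an empty arc that runs from `p` to `q`
if `ε = 1`, and from `q` to `p` if `ε = -1`. -/
def Neighbours (D : GaussDiagram ι) (ε : ℤˣ) (p q : CirclePoint ι) : Prop :=
  (ε = 1 ∧ D.EmptyArc p q) ∨ (ε = -1 ∧ D.EmptyArc q p)

/-- Isotopy and the three Reidemeister moves on Gauss diagrams, with all orientations and signs. -/
inductive Move : GaussDiagram ι → GaussDiagram ι → Prop
  /-- Orientation preserving reparametrization of the circles and renumbering of the components. -/
  | isotopy (D D' : GaussDiagram ι) (σ : Equiv.Perm ι)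
      (φ : ι → Equiv.Perm (AddCircle (1 : ℝ)))
      (hφ : ∀ i x y z, btw (φ i x) (φ i y) (φ i z) ↔ btw x y z)
      (h : D'.arrows = D.arrows.image (SignedArrow.map fun p => (σ p.1, φ p.1 p.2))) : Move D D'
  /-- RI: creation of an arrow `a` whose end points are neighbours. -/
  | r1 (D D' : GaussDiagram ι) (a : SignedArrow ι) (ε : ℤˣ)
      (ha : a ∉ D.arrows) (h : D'.arrows = insert a D.arrows)
      (harc : D'.Neighbours ε a.tail a.head) : Move D D'
  /-- RII: creation of two arrows `a`, `b` of opposite signs whose tails are neighbours and whose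
  heads are neighbours. -/
  | r2 (D D' : GaussDiagram ι) (a b : SignedArrow ι) (ε δ : ℤˣ)
      (ha : a ∉ D.arrows) (hb : b ∉ D.arrows) (h : D'.arrows = insert a (insert b D.arrows))
      (hsign : b.sign = -a.sign)
      (htail : D'.Neighbours ε a.tail b.tail) (hhead : D'.Neighbours δ a.head b.head) : Move D D'
  /-- RIII: the crossings are `a` (top strand over middle strand), `b` (top over bottom) and `c`
  (middle over bottom).  The two crossing points on each of the three strands are neighbours, and
  are interchanged by the move.  The sign condition says which orders of the crossing points
  along the three strands come from an actual triangle in the plane. -/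
  | r3 (D D' : GaussDiagram ι) (a b c : SignedArrow ι) (t m s : ℤˣ)
      (ha : a ∈ D.arrows) (hb : b ∈ D.arrows) (hc : c ∈ D.arrows)
      (hab : a ≠ b) (hac : a ≠ c) (hbc : b ≠ c)
      (htop : D.Neighbours t a.tail b.tail)
      (hmid : D.Neighbours m a.head c.tail)
      (hbot : D.Neighbours s b.head c.head)
      (hsign₁ : a.sign * (t * m) = b.sign * (t * s))
      (hsign₂ : b.sign * (t * s) = c.sign * (m * s))
      (h : D'.arrows = (D.arrows \ {a, b, c}) ∪
        {⟨b.tail, c.tail, a.sign⟩, ⟨a.tail, c.head, b.sign⟩, ⟨a.head, b.head, c.sign⟩}) : Move D D'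

/-- Equivalence of diagrams: finite sequences of moves and their inverses. -/
def setoid (ι : Type) : Setoid (GaussDiagram ι) := Relation.EqvGen.setoid Move

/-! ### Unknotting index of a diagram -/

/-- `D` is `(m, k)`-unknottable: virtualizing `m` crossings and changing `k` crossings yields
a diagram of the trivial link. -/
def Unknottable (D : GaussDiagram ι) (m k : ℕ) : Prop :=
  ∃ S T : Finset (SignedArrow ι), S ⊆ D.arrows ∧ T ⊆ D.arrows ∧ Disjoint S T ∧
    S.card = m ∧ T.card = k ∧
    (setoid ι).r ((D.virtualize S).changeCrossings T) (unlink ι)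

theorem unknottable_card (D : GaussDiagram ι) : D.Unknottable D.arrows.card 0 := by
  refine ⟨D.arrows, ∅, Finset.Subset.refl _, Finset.empty_subset _, Finset.disjoint_empty_right _,
    rfl, rfl, ?_⟩
  have h : (D.virtualize D.arrows).changeCrossings ∅ = unlink ι := by
    apply GaussDiagram.ext
    simp [virtualize, changeCrossings, unlink]
  rw [h]

/-- The pairs `(m, k)` for which `D` is `(m, k)`-unknottable, in dictionary order. -/
def unknottingPairs (D : GaussDiagram ι) : Set (ℕ ×ₗ ℕ) :=
  {u | D.Unknottable (ofLex u).1 (ofLex u).2}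

theorem unknottingPairs_nonempty (D : GaussDiagram ι) : D.unknottingPairs.Nonempty :=
  ⟨toLex (D.arrows.card, 0), D.unknottable_card⟩

/-- The unknotting index `U(D)` of a diagram: the minimum in dictionary order. -/
noncomputable def unknottingIndex (D : GaussDiagram ι) : ℕ ×ₗ ℕ :=
  (wellFounded_lt (α := ℕ ×ₗ ℕ)).min D.unknottingPairs D.unknottingPairs_nonempty

/-! ### Linking number and span -/

open Classical in
/-- `lk(D)`: half the sum of the signs of the crossings between different components. -/
noncomputable def lk (D : GaussDiagram ι) : ℚ :=
  (1 / 2) * ∑ a ∈ D.arrows with a.tail.1 ≠ a.head.1, ((a.sign : ℤ) : ℚ)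

open Classical in
/-- The number of crossings of sign `ε` at which the component `i` passes over `j`. -/
noncomputable def overCount (D : GaussDiagram ι) (i j : ι) (ε : ℤˣ) : ℕ :=
  (D.arrows.filter fun a => a.tail.1 = i ∧ a.head.1 = j ∧ a.sign = ε).card

/-- `r₊ - r₋ - ℓ₊ + ℓ₋` for the components `i`, `j`, traversing `i`. -/
noncomputable def wriggle (D : GaussDiagram ι) (i j : ι) : ℤ :=
  (D.overCount i j 1 : ℤ) - D.overCount i j (-1) - D.overCount j i 1 + D.overCount j i (-1)

/-- `span(D)`, the sum of `span(D_i ∪ D_j) = |r₊ - r₋ - ℓ₊ + ℓ₋|` over all pairs of components. -/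
noncomputable def span [Fintype ι] [LinearOrder ι] (D : GaussDiagram ι) : ℕ :=
  ∑ p : ι × ι with p.1 < p.2, (D.wriggle p.1 p.2).natAbs

/-- `Λ(D)`: the sets of `span(D)` crossings whose virtualization makes the span vanish. -/
noncomputable def minimalVirtualizations [Fintype ι] [LinearOrder ι] (D : GaussDiagram ι) :
    Finset (Finset (SignedArrow ι)) :=
  D.arrows.powerset.filter fun S => S.card = D.span ∧ (D.virtualize S).span = 0

open Classical in
/-- Contribution of one arrow to `wriggle`. -/
noncomputable def wriggleTerm (i j : ι) (a : SignedArrow ι) : ℤ :=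
  (if a.tail.1 = i ∧ a.head.1 = j then (a.sign : ℤ) else 0) -
    (if a.tail.1 = j ∧ a.head.1 = i then (a.sign : ℤ) else 0)

theorem overCount_sub (D : GaussDiagram ι) (i j : ι) :
    (D.overCount i j 1 : ℤ) - D.overCount i j (-1) =
      open Classical in
      ∑ a ∈ D.arrows, (if a.tail.1 = i ∧ a.head.1 = j then (a.sign : ℤ) else 0) := by
  classical
  unfold overCount
  rw [Finset.card_filter, Finset.card_filter]
  push_cast
  rw [← Finset.sum_sub_distrib]
  refine Finset.sum_congr rfl fun a _ => ?_
  by_cases h1 : a.tail.1 = i <;> by_cases h2 : a.head.1 = j <;>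
    rcases Int.units_eq_one_or a.sign with h | h <;> simp [h1, h2, h]

theorem wriggle_eq_sum (D : GaussDiagram ι) (i j : ι) :
    D.wriggle i j = ∑ a ∈ D.arrows, wriggleTerm i j a := by
  have h1 := D.overCount_sub i j
  have h2 := D.overCount_sub j i
  unfold wriggleTerm
  rw [Finset.sum_sub_distrib, ← h1, ← h2]
  unfold wriggle
  ring

theorem wriggle_virtualize_singleton (D : GaussDiagram ι) (i j : ι) {a : SignedArrow ι}
    (ha : a ∈ D.arrows) :
    (D.virtualize {a}).wriggle i j = D.wriggle i j - wriggleTerm i j a := by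
  rw [wriggle_eq_sum, wriggle_eq_sum]
  have h : (D.virtualize {a}).arrows = D.arrows.erase a := by
    simp [virtualize, Finset.sdiff_singleton_eq_erase]
  rw [h, ← Finset.add_sum_erase _ _ ha]
  ring

theorem exists_span_virtualize_singleton [Fintype ι] [LinearOrder ι] (D : GaussDiagram ι) {k : ℕ}
    (hk : D.span = k + 1) : ∃ a ∈ D.arrows, (D.virtualize {a}).span = k := by
  classical
  have hne : D.span ≠ 0 := by omega
  obtain ⟨p, hp, hp0⟩ := Finset.exists_ne_zero_of_sum_ne_zero hne
  have hlt : p.1 < p.2 := (Finset.mem_filter.1 hp).2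
  have hw : D.wriggle p.1 p.2 ≠ 0 := by simpa using hp0
  -- an arrow whose contribution has the sign of the sum
  have hex : ∃ a ∈ D.arrows, 0 < wriggleTerm p.1 p.2 a * (D.wriggle p.1 p.2).sign := by
    by_contra hcon
    push Not at hcon
    have h1 : ∑ a ∈ D.arrows, wriggleTerm p.1 p.2 a * (D.wriggle p.1 p.2).sign ≤ 0 :=
      Finset.sum_nonpos hcon
    rw [← Finset.sum_mul, ← wriggle_eq_sum, Int.mul_sign_self] at h1
    have h2 := Int.natAbs_pos.2 hw
    omega
  obtain ⟨a, ha, hpos⟩ := hex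
  refine ⟨a, ha, ?_⟩
  have hterm : ∀ q ∈ Finset.univ.filter (fun q : ι × ι => q.1 < q.2), q ≠ p →
      wriggleTerm q.1 q.2 a = 0 := by
    intro q hq hqp
    have hq' : q.1 < q.2 := (Finset.mem_filter.1 hq).2
    have hcase : (a.tail.1 = p.1 ∧ a.head.1 = p.2) ∨ (a.tail.1 = p.2 ∧ a.head.1 = p.1) := by
      by_contra hcon
      push Not at hcon
      have : wriggleTerm p.1 p.2 a = 0 := by
        unfold wriggleTerm
        rw [if_neg (fun h => hcon.1 h.1 h.2), if_neg (fun h => hcon.2 h.1 h.2), sub_zero]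
      simp [this] at hpos
    unfold wriggleTerm
    rw [if_neg, if_neg, sub_zero]
    · rintro ⟨e1, e2⟩
      rcases hcase with ⟨c1, c2⟩ | ⟨c1, c2⟩
      · rw [← e1, ← e2, c1, c2] at hq'
        exact lt_asymm hlt hq'
      · exact hqp (Prod.ext (e2.symm.trans c2) (e1.symm.trans c1))
    · rintro ⟨e1, e2⟩
      rcases hcase with ⟨c1, c2⟩ | ⟨c1, c2⟩
      · exact hqp (Prod.ext (e1.symm.trans c1) (e2.symm.trans c2))
      · rw [← e1, ← e2, c1, c2] at hq'
        exact lt_asymm hlt hq'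
  have habs : (wriggleTerm p.1 p.2 a).natAbs ≤ 1 := by
    have hne' : ¬ (a.tail.1 = p.1 ∧ a.head.1 = p.2 ∧ a.tail.1 = p.2 ∧ a.head.1 = p.1) := by
      rintro ⟨e1, -, e3, -⟩
      exact hlt.ne (e1.symm.trans e3)
    unfold wriggleTerm
    rcases Int.units_eq_one_or a.sign with h | h <;> rw [h] <;> split_ifs <;> simp
  have hmain : ((D.virtualize {a}).wriggle p.1 p.2).natAbs + 1 = (D.wriggle p.1 p.2).natAbs := by
    rw [wriggle_virtualize_singleton D _ _ ha]
    rcases lt_or_gt_of_ne hw with h | h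
    · rw [Int.sign_eq_neg_one_of_neg h] at hpos
      omega
    · rw [Int.sign_eq_one_of_pos h] at hpos
      omega
  unfold span at hk ⊢
  rw [← Finset.add_sum_erase _ _ hp] at hk ⊢
  have hrest : ∑ q ∈ (Finset.univ.filter (fun q : ι × ι => q.1 < q.2)).erase p,
      ((D.virtualize {a}).wriggle q.1 q.2).natAbs =
      ∑ q ∈ (Finset.univ.filter (fun q : ι × ι => q.1 < q.2)).erase p,
      (D.wriggle q.1 q.2).natAbs := by
    refine Finset.sum_congr rfl fun q hq => ?_
    rw [wriggle_virtualize_singleton D _ _ ha,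
      hterm q (Finset.mem_of_mem_erase hq) (Finset.ne_of_mem_erase hq), sub_zero]
  rw [hrest]
  omega

theorem minimalVirtualizations_nonempty [Fintype ι] [LinearOrder ι] (D : GaussDiagram ι) :
    D.minimalVirtualizations.Nonempty := by
  classical
  suffices h : ∀ k (D : GaussDiagram ι), D.span = k →
      ∃ S ⊆ D.arrows, S.card = k ∧ (D.virtualize S).span = 0 by
    obtain ⟨S, hS, hc, h0⟩ := h _ D rfl
    exact ⟨S, Finset.mem_filter.2 ⟨Finset.mem_powerset.2 hS, hc, h0⟩⟩
  intro k
  induction k with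
  | zero =>
    intro D hD
    refine ⟨∅, Finset.empty_subset _, rfl, ?_⟩
    have : D.virtualize ∅ = D := GaussDiagram.ext (by simp [virtualize])
    rw [this, hD]
  | succ k ih =>
    intro D hD
    obtain ⟨a, ha, hspan⟩ := D.exists_span_virtualize_singleton hD
    obtain ⟨S, hS, hc, h0⟩ := ih _ hspan
    have haS : a ∉ S := fun h => by
      have := hS h
      simp [virtualize] at this
    refine ⟨insert a S, ?_, ?_, ?_⟩
    · refine Finset.insert_subset ha (hS.trans ?_)
      exact Finset.sdiff_subset
    · rw [Finset.card_insert_of_notMem haS, hc]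
    · have : D.virtualize (insert a S) = (D.virtualize {a}).virtualize S := by
        apply GaussDiagram.ext
        ext x
        simp [virtualize, and_assoc]
      rw [this, h0]

/-- `ℓ_D`, the minimum of `|lk(D_S)|` over `S ∈ Λ(D)`. -/
noncomputable def ell [Fintype ι] [LinearOrder ι] (D : GaussDiagram ι) : ℚ :=
  D.minimalVirtualizations.inf' D.minimalVirtualizations_nonempty fun S => |(D.virtualize S).lk|

/-! ### Index and writhes of a virtual knot diagram -/

open Classical in
/-- The number of chords of sign `ε` of a knot diagram that cross the chord `c` from right to left.
With counterclockwise circles, the arc from the tail of `c` to its head is on the right of `c`. -/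
noncomputable def rightToLeft [Unique ι] (D : GaussDiagram ι) (c : SignedArrow ι) (ε : ℤˣ) : ℕ :=
  (D.arrows.filter fun d => sbtw c.tail.2 d.tail.2 c.head.2 ∧ sbtw c.head.2 d.head.2 c.tail.2 ∧
    d.sign = ε).card

open Classical in
/-- The number of chords of sign `ε` of a knot diagram that cross the chord `c` from left to
right. -/
noncomputable def leftToRight [Unique ι] (D : GaussDiagram ι) (c : SignedArrow ι) (ε : ℤˣ) : ℕ :=
  (D.arrows.filter fun d => sbtw c.head.2 d.tail.2 c.tail.2 ∧ sbtw c.tail.2 d.head.2 c.head.2 ∧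
    d.sign = ε).card

/-- The index `Ind(c)` of a chord of a virtual knot diagram. -/
noncomputable def index [Unique ι] (D : GaussDiagram ι) (c : SignedArrow ι) : ℤ :=
  (D.rightToLeft c 1 : ℤ) - D.rightToLeft c (-1) - D.leftToRight c 1 + D.leftToRight c (-1)

/-- The `k`-th writhe `J_k(D)` of a virtual knot diagram. -/
noncomputable def writhe [Unique ι] (D : GaussDiagram ι) (k : ℤ) : ℤ :=
  ∑ c ∈ D.arrows with D.index c = k, (c.sign : ℤ)

/-- Only finitely many writhes are nonzero, so that sums over all `k` make sense. -/
theorem writhe_support_finite [Unique ι] (D : GaussDiagram ι) :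
    (Function.support D.writhe).Finite := by
  classical
  refine (D.arrows.image D.index).finite_toSet.subset fun k hk => ?_
  obtain ⟨c, hc, -⟩ := Finset.exists_ne_zero_of_sum_ne_zero hk
  obtain ⟨hc1, hc2⟩ := Finset.mem_filter.1 hc
  exact Finset.mem_coe.2 (Finset.mem_image.2 ⟨c, hc1, hc2⟩)

end GaussDiagram

/-- Virtual links with `n` (oriented) components: diagrams up to equivalence. -/
def VirtualLink (n : ℕ) : Type := Quotient (GaussDiagram.setoid (Fin n))

namespace VirtualLink

/-- `D` is a diagram of the virtual link `L`. -/
def IsDiagram {n : ℕ} (D : GaussDiagram (Fin n)) (L : VirtualLink n) : Prop :=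
  Quotient.mk (GaussDiagram.setoid (Fin n)) D = L

theorem diagrams_nonempty {n : ℕ} (L : VirtualLink n) :
    (GaussDiagram.unknottingIndex '' {D : GaussDiagram (Fin n) | IsDiagram D L}).Nonempty := by
  obtain ⟨D, hD⟩ := Quotient.exists_rep L
  exact ⟨_, D, hD, rfl⟩

/-- The unknotting index `U(L)`: the minimum of `U(D)` over all diagrams `D` of `L`. -/
noncomputable def unknottingIndex {n : ℕ} (L : VirtualLink n) : ℕ ×ₗ ℕ :=
  (wellFounded_lt (α := ℕ ×ₗ ℕ)).min
    (GaussDiagram.unknottingIndex '' {D : GaussDiagram (Fin n) | IsDiagram D L})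
    L.diagrams_nonempty

end VirtualLink

/-! For distinct components let `overLk i j` be the sum of the signs of the crossings at which `i`
passes over `j`. Write r and l for its values on (i, j) and (j, i). The proof rests on two families
of quantities that are invariant up to renumbering of the components: these numbers, and the writhes
`selfWrithe i k` with k ≠ 0 (`sameInvariants_of_equiv`). They determine the span and the writhe sum,
and they bound each `ell` from above, so the estimate can be made on a diagram `E` of the link that
realizes the unknotting index. There, virtualizing `S` and changing `T` makes all these quantities
vanish.

A crossing change turns an i-over-j crossing of sign s into a j-over-i crossing of sign -s. It
lowers r and l by the same s, so r - l can only be destroyed by virtualization, and every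
virtualized crossing alters one difference by one at most. Hence span ≤ |S|. If the inequality is
strict, the dictionary order leaves nothing more to prove. If it is an equality, no virtualization
is wasted: `S` contains no self crossing, and for each pair virtualization brings r and l to a
common value c between them. Then |c| is at least `ellBound r l`, the distance of 0 from the
interval between r and l (`ellBound_le_of_sum`), and at least |c| changes are needed between the two
components. In the other direction a greedy virtualization shows `ell` ≤ `ellBound`
(`exists_virtualization`).

Since `S` contains no self crossing, the writhes are untouched by it. Changing a self crossing
reverses its sign and its index, so it affects only the writhes at ±Ind, each by one if Ind ≠ 0;
whence the factor 1/2 (`selfWrithe_changeCrossings`, `finsum_abs_le`). Every changed crossing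
belongs either to one pair of components or to one component, so the bounds add up
(`bound_of_unknotting`). -/

section CircularOrder

/-! ### Arcs in a circular order. -/

variable {α : Type*} [CircularOrder α]

theorem sbtw_or_sbtw_of_ne {a b c : α} (hab : a ≠ b) (hbc : b ≠ c) (hca : c ≠ a) :
    sbtw a b c ∨ sbtw c b a := by
  by_contra! h
  rw [sbtw_iff_not_btw, sbtw_iff_not_btw, not_not, not_not] at h
  rcases btw_antisymm h.1 h.2 with h | h | h
  · exact hbc h.symm
  · exact hab h.symm
  · exact hca h.symm

theorem ne_of_sbtw {a b c : α} (h : sbtw a b c) : a ≠ b ∧ b ≠ c ∧ c ≠ a := by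
  refine ⟨?_, ?_, ?_⟩
  · rintro rfl; exact sbtw_irrefl_left h
  · rintro rfl; exact sbtw_irrefl_right h
  · rintro rfl; exact sbtw_irrefl_left_right h

/-- If neither `z` nor `w` lies on the arc from `p` to `q`, then `p` and `q` are interchangeable
with respect to `z` and `w`. -/
theorem sbtw_congr_left_of_sbtw {p q z w : α} (hz : sbtw q z p) (hw : sbtw q w p) :
    sbtw p z w ↔ sbtw q z w := by
  obtain ⟨hqz, hzp, hpq⟩ := ne_of_sbtw hz
  obtain ⟨hqw, hwp, -⟩ := ne_of_sbtw hw
  constructor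
  · intro h
    -- The opposite cyclic order of `q`, `z`, `w`, chained with `h`, would put `z` on the arc from
    -- `p` to `q`.
    rcases sbtw_or_sbtw_of_ne hqz (ne_of_sbtw h).2.1 hqw.symm with h1 | h1
    · exact h1
    · exact absurd hz.cyclic_left
        (sbtw_asymm (h1.cyclic_right.trans_left h.cyclic_right))
  · intro h
    rcases sbtw_or_sbtw_of_ne hzp.symm (ne_of_sbtw h).2.1 hwp with h1 | h1
    · exact h1
    · exact absurd hw.cyclic_left (sbtw_asymm (h.trans_left h1.cyclic_left))

open Classical in
/-- The indicator function of the open arc from `p` to `q`. -/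
noncomputable def arcIndicator (p q x : α) : ℤ := if sbtw p x q then 1 else 0

theorem arcIndicator_eq {β : Type*} [CircularOrder β] {p q x : α} {p' q' x' : β}
    (h : sbtw p x q ↔ sbtw p' x' q') : arcIndicator p q x = arcIndicator p' q' x' := by
  classical
  exact if_congr h rfl rfl

theorem arcIndicator_cyclic (p q x : α) : arcIndicator p q x = arcIndicator x p q :=
  arcIndicator_eq ⟨fun h => h.cyclic_left, fun h => h.cyclic_right⟩

theorem arcIndicator_self_left (p q : α) : arcIndicator p q p = 0 := if_neg sbtw_irrefl_left

theorem arcIndicator_self_right (p q : α) : arcIndicator p q q = 0 := if_neg sbtw_irrefl_right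

end CircularOrder

/-! ### End points and neighbours on a Gauss diagram. -/

namespace GaussDiagram

variable {ι : Type}

/-- `x` is an end point of an arrow of `D`. -/
def IsEndpoint (D : GaussDiagram ι) (x : CirclePoint ι) : Prop :=
  ∃ a ∈ D.arrows, x = a.tail ∨ x = a.head

theorem isEndpoint_tail {D : GaussDiagram ι} {a : SignedArrow ι} (ha : a ∈ D.arrows) :
    D.IsEndpoint a.tail := ⟨a, ha, Or.inl rfl⟩

theorem isEndpoint_head {D : GaussDiagram ι} {a : SignedArrow ι} (ha : a ∈ D.arrows) :
    D.IsEndpoint a.head := ⟨a, ha, Or.inr rfl⟩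

namespace Neighbours

variable {D : GaussDiagram ι} {ε : ℤˣ} {p q z w : CirclePoint ι}

theorem symm (h : D.Neighbours ε p q) : D.Neighbours (-ε) q p := by
  rcases h with ⟨rfl, h⟩ | ⟨rfl, h⟩
  · exact Or.inr ⟨rfl, h⟩
  · exact Or.inl ⟨by simp, h⟩

theorem fst_eq (h : D.Neighbours ε p q) : p.1 = q.1 := by
  rcases h with ⟨-, h⟩ | ⟨-, h⟩
  · exact h.1
  · exact h.1.symm

theorem ne (h : D.Neighbours ε p q) : p ≠ q := by
  rintro rfl
  rcases h with ⟨-, h⟩ | ⟨-, h⟩ <;> exact h.2.1 rfl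

end Neighbours

theorem snd_ne_of_ne {p q : CirclePoint ι} (h1 : p.1 = q.1) (h : p ≠ q) : p.2 ≠ q.2 :=
  fun h2 => h (Prod.ext h1 h2)

/-- The arc from `p` to `q` being empty, any other end point on the circle is forced onto the
complementary arc. -/
theorem EmptyArc.sbtw {D : GaussDiagram ι} {p q z : CirclePoint ι} (h : D.EmptyArc p q)
    (hz : D.IsEndpoint z) (hzp : z.1 = p.1) (hne : z ≠ p) (hne' : z ≠ q) : sbtw q.2 z.2 p.2 := by
  obtain ⟨a, ha, hza⟩ := hz
  have h1 := h.2.2 a ha z hza hzp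
  have h2 := snd_ne_of_ne hzp hne
  have h3 := snd_ne_of_ne (hzp.trans h.1) hne'
  exact (sbtw_or_sbtw_of_ne h2.symm h3 h.2.1.symm).resolve_left h1

namespace Neighbours

variable {D : GaussDiagram ι} {ε : ℤˣ} {p q z w : CirclePoint ι}

theorem sbtw_congr_left (h : D.Neighbours ε p q) (hz : D.IsEndpoint z) (hw : D.IsEndpoint w)
    (hz1 : z.1 = p.1) (hw1 : w.1 = p.1) (hzp : z ≠ p) (hzq : z ≠ q) (hwp : w ≠ p) (hwq : w ≠ q) :
    sbtw p.2 z.2 w.2 ↔ sbtw q.2 z.2 w.2 := by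
  rcases h with ⟨-, h⟩ | ⟨-, h⟩
  · exact sbtw_congr_left_of_sbtw (h.sbtw hz hz1 hzp hzq) (h.sbtw hw hw1 hwp hwq)
  · exact (sbtw_congr_left_of_sbtw (h.sbtw hz (hz1.trans h.1.symm) hzq hzp)
      (h.sbtw hw (hw1.trans h.1.symm) hwq hwp)).symm

/-- The indicator of an arc does not distinguish neighbours. -/
theorem arcIndicator_congr (h : D.Neighbours ε p q) (hz : D.IsEndpoint z) (hw : D.IsEndpoint w)
    (hz1 : z.1 = p.1) (hw1 : w.1 = p.1) (hzp : z ≠ p) (hzq : z ≠ q) (hwp : w ≠ p) (hwq : w ≠ q) :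
    arcIndicator z.2 w.2 p.2 = arcIndicator z.2 w.2 q.2 := by
  have h1 := h.sbtw_congr_left hw hz hw1 hz1 hwp hwq hzp hzq
  have : sbtw z.2 p.2 w.2 ↔ sbtw z.2 q.2 w.2 :=
    ⟨fun h => (h1.1 h.cyclic_left).cyclic_right, fun h => (h1.2 h.cyclic_left).cyclic_right⟩
  exact arcIndicator_eq this

theorem arcIndicator_congr_left (h : D.Neighbours ε p q) (hz : D.IsEndpoint z)
    (hw : D.IsEndpoint w) (hz1 : z.1 = p.1) (hw1 : w.1 = p.1) (hzp : z ≠ p) (hzq : z ≠ q)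
    (hwp : w ≠ p) (hwq : w ≠ q) :
    arcIndicator p.2 z.2 w.2 = arcIndicator q.2 z.2 w.2 :=
  arcIndicator_eq (h.sbtw_congr_left hw hz hw1 hz1 hwp hwq hzp hzq)

theorem arcIndicator_congr_right (h : D.Neighbours ε p q) (hz : D.IsEndpoint z)
    (hw : D.IsEndpoint w) (hz1 : z.1 = p.1) (hw1 : w.1 = p.1) (hzp : z ≠ p) (hzq : z ≠ q)
    (hwp : w ≠ p) (hwq : w ≠ q) :
    arcIndicator w.2 p.2 z.2 = arcIndicator w.2 q.2 z.2 := by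
  have h1 := h.sbtw_congr_left hw hz hw1 hz1 hwp hwq hzp hzq
  have : sbtw w.2 z.2 p.2 ↔ sbtw w.2 z.2 q.2 :=
    ⟨fun h => (h1.1 h.cyclic_right).cyclic_left, fun h => (h1.2 h.cyclic_right).cyclic_left⟩
  exact arcIndicator_eq this

/-- Whether the arc from a point to another end point contains the neighbour of the former. -/
theorem two_mul_arcIndicator_left (h : D.Neighbours ε p q) (hz : D.IsEndpoint z)
    (hz1 : z.1 = p.1) (hzp : z ≠ p) (hzq : z ≠ q) :
    2 * arcIndicator p.2 z.2 q.2 = 1 + ε := by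
  rcases h with ⟨rfl, h⟩ | ⟨rfl, h⟩
  · rw [arcIndicator, if_pos (h.sbtw hz hz1 hzp hzq).cyclic_right]; rfl
  · rw [arcIndicator, if_neg]
    · rfl
    · exact fun h' => sbtw_asymm h'
        (h.sbtw hz (hz1.trans h.1.symm) hzq hzp).cyclic_left

/-- The arc from `z` to `p` contains `q` exactly when `q` comes just before `p`, that is for `ε =
-1`. Doubling makes the indicator affine in the sign, so that later comparisons are linear
arithmetic over the integers. -/
theorem two_mul_arcIndicator_right (h : D.Neighbours ε p q) (hz : D.IsEndpoint z)
    (hz1 : z.1 = p.1) (hzp : z ≠ p) (hzq : z ≠ q) :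
    2 * arcIndicator z.2 p.2 q.2 = 1 - ε := by
  rcases h with ⟨rfl, h⟩ | ⟨rfl, h⟩
  · rw [arcIndicator, if_neg]
    · rfl
    · exact fun h' => sbtw_asymm h' (h.sbtw hz hz1 hzp hzq).cyclic_right
  · rw [arcIndicator, if_pos
      (h.sbtw hz (hz1.trans h.1.symm) hzq hzp).cyclic_left]; rfl

end Neighbours

end GaussDiagram

/-! ### Chord terms and the invariants of a diagram. -/

namespace SignedArrow

variable {ι κ : Type}

/-- Both end points of the arrow lie on the circle `i`. -/
def IsSelf (a : SignedArrow ι) (i : ι) : Prop := a.tail.1 = i ∧ a.head.1 = i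

/-- Contribution of the chord `d` to the index of the chord `c` of the same circle. -/
noncomputable def chordTerm (c d : SignedArrow ι) : ℤ :=
  d.sign * (arcIndicator c.tail.2 c.head.2 d.tail.2 - arcIndicator c.tail.2 c.head.2 d.head.2)

theorem chordTerm_self (c : SignedArrow ι) : c.chordTerm c = 0 := by
  simp [chordTerm, arcIndicator_self_left, arcIndicator_self_right]

end SignedArrow

namespace GaussDiagram

open SignedArrow

variable {ι : Type}

theorem tail_ne_tail (D : GaussDiagram ι) {a b : SignedArrow ι} (ha : a ∈ D.arrows)
    (hb : b ∈ D.arrows) (h : a ≠ b) : a.tail ≠ b.tail := fun e => h (D.tail_inj a ha b hb e)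

theorem head_ne_head (D : GaussDiagram ι) {a b : SignedArrow ι} (ha : a ∈ D.arrows)
    (hb : b ∈ D.arrows) (h : a ≠ b) : a.head ≠ b.head := fun e => h (D.head_inj a ha b hb e)

open Classical in
/-- The sum of the signs of the crossings at which the component `i` passes over `j`. -/
noncomputable def overLk (D : GaussDiagram ι) (i j : ι) : ℤ :=
  ∑ a ∈ D.arrows, if a.tail.1 = i ∧ a.head.1 = j then (a.sign : ℤ) else 0

open Classical in
/-- The index of the chord `c` in the component `i`. -/
noncomputable def selfIndex (D : GaussDiagram ι) (i : ι) (c : SignedArrow ι) : ℤ :=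
  ∑ d ∈ D.arrows, if d.IsSelf i then c.chordTerm d else 0

open Classical in
/-- The `k`-th writhe of the component `i`. -/
noncomputable def selfWrithe (D : GaussDiagram ι) (i : ι) (k : ℤ) : ℤ :=
  ∑ c ∈ D.arrows, if c.IsSelf i ∧ D.selfIndex i c = k then (c.sign : ℤ) else 0

/-- Up to a renumbering of the components, the diagrams have the same linking numbers and the same
writhes. -/
def SameInvariants (D D' : GaussDiagram ι) : Prop :=
  ∃ σ : Equiv.Perm ι, (∀ i j, i ≠ j → D'.overLk (σ i) (σ j) = D.overLk i j) ∧
    ∀ i k, k ≠ 0 → D'.selfWrithe (σ i) k = D.selfWrithe i k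

namespace SameInvariants

variable {D D' D'' : GaussDiagram ι}

theorem refl (D : GaussDiagram ι) : SameInvariants D D :=
  ⟨1, fun _ _ _ => rfl, fun _ _ _ => rfl⟩

theorem symm (h : SameInvariants D D') : SameInvariants D' D := by
  obtain ⟨σ, h1, h2⟩ := h
  refine ⟨σ.symm, fun i j hij => ?_, fun i k hk => ?_⟩
  · rw [← h1 _ _ (fun h => hij (σ.symm.injective h)), σ.apply_symm_apply, σ.apply_symm_apply]
  · rw [← h2 _ _ hk, σ.apply_symm_apply]

theorem trans (h : SameInvariants D D') (h' : SameInvariants D' D'') : SameInvariants D D'' := by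
  obtain ⟨σ, h1, h2⟩ := h
  obtain ⟨σ', h1', h2'⟩ := h'
  refine ⟨σ.trans σ', fun i j hij => ?_, fun i k hk => ?_⟩
  · rw [← h1 _ _ hij, ← h1' _ _ (fun h => hij (σ.injective h))]; rfl
  · rw [← h2 _ _ hk, ← h2' _ _ hk]; rfl

end SameInvariants

/-- Diagrams that differ by a map of points which is compatible with indices. -/
theorem sameInvariants_of_image {D D' : GaussDiagram ι} (σ : Equiv.Perm ι)
    {f : CirclePoint ι → CirclePoint ι} (hf : Function.Injective f)
    (h : D'.arrows = D.arrows.image (SignedArrow.map f))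
    (hfst : ∀ x, D.IsEndpoint x → (f x).1 = σ x.1)
    (hidx : ∀ i, ∀ c ∈ D.arrows, c.IsSelf i →
      ∑ d ∈ D.arrows, (open Classical in if d.IsSelf i then (c.map f).chordTerm (d.map f) else 0) =
        D.selfIndex i c) : SameInvariants D D' := by
  classical
  have hinj := (SignedArrow.map_injective hf).injOn (s := (D.arrows : Set (SignedArrow ι)))
  have hself : ∀ c ∈ D.arrows, ∀ i j, ((c.map f).tail.1 = σ i ∧ (c.map f).head.1 = σ j) ↔
      (c.tail.1 = i ∧ c.head.1 = j) := by
    intro c hc i j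
    simp only [SignedArrow.map, hfst _ (isEndpoint_tail hc), hfst _ (isEndpoint_head hc),
      EmbeddingLike.apply_eq_iff_eq]
  refine ⟨σ, fun i j _ => ?_, fun i k _ => ?_⟩
  · unfold overLk
    rw [h, Finset.sum_image hinj]
    exact Finset.sum_congr rfl fun c hc => if_congr (hself c hc i j) rfl rfl
  · unfold selfWrithe
    rw [h, Finset.sum_image hinj]
    refine Finset.sum_congr rfl fun c hc => ?_
    refine if_congr ((and_congr_left_iff.2 fun _ => hself c hc i i).trans
      (and_congr_right_iff.2 fun hs => ?_)) rfl rfl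
    rw [← hidx i c hc hs, selfIndex, h, Finset.sum_image hinj]
    exact Iff.of_eq (congrArg (· = k)
      (Finset.sum_congr rfl fun d hd => if_congr (hself d hd i i) rfl rfl))

theorem sameInvariants_isotopy {D D' : GaussDiagram ι} (σ : Equiv.Perm ι)
    (φ : ι → Equiv.Perm (AddCircle (1 : ℝ)))
    (hφ : ∀ i x y z, btw (φ i x) (φ i y) (φ i z) ↔ btw x y z)
    (h : D'.arrows = D.arrows.image (SignedArrow.map fun p => (σ p.1, φ p.1 p.2))) :
    SameInvariants D D' := by
  refine sameInvariants_of_image σ ?_ h (fun _ _ => rfl) fun i c _ hs => ?_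
  · rintro ⟨i, x⟩ ⟨j, y⟩ hxy
    obtain ⟨h1, h2⟩ := Prod.mk.inj hxy
    obtain rfl : i = j := σ.injective h1
    exact Prod.ext rfl ((φ i).injective h2)
  · refine Finset.sum_congr rfl fun d _ => ?_
    by_cases hd : d.IsSelf i
    · have hs' : ∀ x y z, sbtw (φ i x) (φ i y) (φ i z) ↔ sbtw x y z := fun x y z => by
        rw [sbtw_iff_not_btw, sbtw_iff_not_btw, hφ]
      rw [if_pos hd, if_pos hd]
      simp only [chordTerm, SignedArrow.map, hs.1, hs.2, hd.1, hd.2]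
      rw [arcIndicator_eq (hs' _ _ _), arcIndicator_eq (hs' _ _ _)]
    · rw [if_neg hd, if_neg hd]

namespace Neighbours

variable {D : GaussDiagram ι} {ε δ : ℤˣ} {a b c d : SignedArrow ι} {i : ι}

/-- An arrow whose end points are neighbours does not contribute to indices. -/
theorem chordTerm_eq_zero (h : D.Neighbours ε a.tail a.head) (ha : a ∈ D.arrows)
    (hc : c ∈ D.arrows) (hca : c ≠ a) (hai : a.IsSelf i) (hci : c.IsSelf i) :
    c.chordTerm a = 0 := by
  rw [chordTerm, h.arcIndicator_congr (isEndpoint_tail hc) (isEndpoint_head hc)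
    (hci.1.trans hai.1.symm) (hci.2.trans hai.1.symm) (D.tail_ne_tail hc ha hca)
    (D.tail_ne_head c hc a ha) (D.tail_ne_head a ha c hc).symm (D.head_ne_head hc ha hca),
    sub_self, mul_zero]

/-- An arrow whose end points are neighbours has index zero. -/
theorem chordTerm_eq_zero' (h : D.Neighbours ε a.tail a.head) (ha : a ∈ D.arrows)
    (hc : c ∈ D.arrows) (hca : c ≠ a) (hai : a.IsSelf i) (hci : c.IsSelf i) :
    a.chordTerm c = 0 := by
  have h1 := h.two_mul_arcIndicator_right (isEndpoint_tail hc) (hci.1.trans hai.1.symm)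
    (D.tail_ne_tail hc ha hca) (D.tail_ne_head c hc a ha)
  have h2 := h.two_mul_arcIndicator_right (isEndpoint_head hc) (hci.2.trans hai.1.symm)
    (D.tail_ne_head a ha c hc).symm (D.head_ne_head hc ha hca)
  rw [← arcIndicator_cyclic] at h1 h2
  have h3 : arcIndicator a.tail.2 a.head.2 c.tail.2 = arcIndicator a.tail.2 a.head.2 c.head.2 := by
    omega
  rw [chordTerm, h3, sub_self, mul_zero]

/-- Two parallel arrows of opposite signs do not contribute to indices. -/
theorem chordTerm_add_chordTerm (htail : D.Neighbours ε a.tail b.tail)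
    (hhead : D.Neighbours δ a.head b.head) (hsign : b.sign = -a.sign) (ha : a ∈ D.arrows)
    (hb : b ∈ D.arrows) (hc : c ∈ D.arrows) (hca : c ≠ a) (hcb : c ≠ b) (hai : a.IsSelf i)
    (hci : c.IsSelf i) : c.chordTerm a + c.chordTerm b = 0 := by
  rw [chordTerm, chordTerm, hsign, htail.arcIndicator_congr (isEndpoint_tail hc)
    (isEndpoint_head hc) (hci.1.trans hai.1.symm) (hci.2.trans hai.1.symm)
    (D.tail_ne_tail hc ha hca) (D.tail_ne_tail hc hb hcb) (D.tail_ne_head a ha c hc).symm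
    (D.tail_ne_head b hb c hc).symm, hhead.arcIndicator_congr (isEndpoint_tail hc)
    (isEndpoint_head hc) (hci.1.trans hai.2.symm) (hci.2.trans hai.2.symm)
    (D.tail_ne_head c hc a ha) (D.tail_ne_head c hc b hb) (D.head_ne_head hc ha hca)
    (D.head_ne_head hc hb hcb), Units.val_neg]
  ring

/-- An arrow contributes equally to the indices of two parallel arrows. -/
theorem chordTerm_congr (htail : D.Neighbours ε a.tail b.tail)
    (hhead : D.Neighbours δ a.head b.head) (ha : a ∈ D.arrows)
    (hb : b ∈ D.arrows) (hc : c ∈ D.arrows) (hca : c ≠ a) (hcb : c ≠ b) (hai : a.IsSelf i)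
    (hci : c.IsSelf i) : a.chordTerm c = b.chordTerm c := by
  have key : ∀ x, D.IsEndpoint x → x.1 = i → x ≠ a.tail → x ≠ b.tail → x ≠ a.head → x ≠ b.head →
      arcIndicator a.tail.2 a.head.2 x.2 = arcIndicator b.tail.2 b.head.2 x.2 := by
    intro x hx hxi h1 h2 h3 h4
    rw [htail.arcIndicator_congr_left (isEndpoint_head ha) hx (hai.2.trans hai.1.symm)
        (hxi.trans hai.1.symm) (D.tail_ne_head a ha a ha).symm (D.tail_ne_head b hb a ha).symm
        h1 h2]
    exact hhead.arcIndicator_congr_right hx (isEndpoint_tail hb) (hxi.trans hai.2.symm)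
        (htail.fst_eq.symm.trans (hai.1.trans hai.2.symm)) h3 h4 (D.tail_ne_head b hb a ha)
        (D.tail_ne_head b hb b hb)
  rw [chordTerm, chordTerm, key _ (isEndpoint_tail hc) hci.1 (D.tail_ne_tail hc ha hca)
    (D.tail_ne_tail hc hb hcb) (D.tail_ne_head c hc a ha) (D.tail_ne_head c hc b hb),
    key _ (isEndpoint_head hc) hci.2 (D.tail_ne_head a ha c hc).symm
    (D.tail_ne_head b hb c hc).symm (D.head_ne_head hc ha hca) (D.head_ne_head hc hb hcb)]

/-- Two parallel arrows of opposite signs contribute equally to each other's index. -/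
theorem chordTerm_comm (htail : D.Neighbours ε a.tail b.tail)
    (hhead : D.Neighbours δ a.head b.head) (hsign : b.sign = -a.sign) (ha : a ∈ D.arrows)
    (hb : b ∈ D.arrows) (hai : a.IsSelf i) : a.chordTerm b = b.chordTerm a := by
  have hth : a.head.1 = a.tail.1 := hai.2.trans hai.1.symm
  have e1 := htail.two_mul_arcIndicator_left (isEndpoint_head ha) hth
    (D.tail_ne_head a ha a ha).symm (D.tail_ne_head b hb a ha).symm
  have e2 := hhead.two_mul_arcIndicator_right (isEndpoint_tail ha) hth.symm
    (D.tail_ne_head a ha a ha) (D.tail_ne_head a ha b hb)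
  have e3 := htail.symm.two_mul_arcIndicator_left (isEndpoint_head hb)
    (hhead.fst_eq.symm.trans (hth.trans htail.fst_eq)) (D.tail_ne_head b hb b hb).symm
    (D.tail_ne_head a ha b hb).symm
  have e4 := hhead.symm.two_mul_arcIndicator_right (isEndpoint_tail hb)
    (htail.fst_eq.symm.trans (hth.symm.trans hhead.fst_eq)) (D.tail_ne_head b hb b hb)
    (D.tail_ne_head b hb a ha)
  rw [chordTerm, chordTerm, hsign]
  rw [Units.val_neg] at e3 e4 ⊢
  -- By `e1`–`e4` the two differences are (ε + δ)/2 and -(ε + δ)/2; the opposite signs of the arrows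
  -- compensate for this.
  have : arcIndicator a.tail.2 a.head.2 b.tail.2 - arcIndicator a.tail.2 a.head.2 b.head.2 =
      -(arcIndicator b.tail.2 b.head.2 a.tail.2 - arcIndicator b.tail.2 b.head.2 a.head.2) := by
    omega
  rw [this]
  ring

end Neighbours

/-! ### Invariance under RI and RII. -/

/-- No other chord separates the end points of the new one. It therefore contributes to no index and
has index 0 itself, so it is seen only by the writhe with k = 0, which is excluded. -/
theorem sameInvariants_r1 {D D' : GaussDiagram ι} {a : SignedArrow ι} {ε : ℤˣ}
    (ha : a ∉ D.arrows) (h : D'.arrows = insert a D.arrows)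
    (harc : D'.Neighbours ε a.tail a.head) : SameInvariants D D' := by
  classical
  have ha' : a ∈ D'.arrows := h ▸ Finset.mem_insert_self _ _
  have hD : ∀ c ∈ D.arrows, c ∈ D'.arrows ∧ c ≠ a := fun c hc =>
    ⟨h ▸ Finset.mem_insert_of_mem hc, fun e => ha (e ▸ hc)⟩
  refine ⟨1, fun i j hij => ?_, fun i k hk => ?_⟩
  · rw [overLk, h, Finset.sum_insert ha, if_neg, zero_add]
    · rfl
    · rintro ⟨h1, h2⟩
      exact hij (h1.symm.trans (harc.fst_eq.trans h2))
  · have hidx : ∀ c ∈ D.arrows, c.IsSelf i → D'.selfIndex i c = D.selfIndex i c := by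
      intro c hc hci
      rw [selfIndex, selfIndex, h, Finset.sum_insert ha, add_eq_right]
      split_ifs with hai
      · exact harc.chordTerm_eq_zero ha' (hD c hc).1 (hD c hc).2 hai hci
      · rfl
    have hidxa : a.IsSelf i → D'.selfIndex i a = 0 := by
      intro hai
      refine Finset.sum_eq_zero fun c hc => ?_
      split_ifs with hci
      · by_cases hca : c = a
        · rw [hca, chordTerm_self]
        · exact harc.chordTerm_eq_zero' ha' hc hca hai hci
      · rfl
    change D'.selfWrithe i k = _
    rw [selfWrithe, h, Finset.sum_insert ha, if_neg, zero_add]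
    · refine Finset.sum_congr rfl fun c hc => if_congr ?_ rfl rfl
      exact and_congr_right_iff.2 fun hci => by rw [hidx c hc hci]
    · rintro ⟨h1, h2⟩
      exact hk (h2.symm.trans (hidxa h1))

/-- The two new arrows connect the same circles with opposite signs, so they cancel in the linking
numbers and in the indices of other chords. When they are self arrows they have equal indices, so
they also cancel within a single writhe. -/
theorem sameInvariants_r2 {D D' : GaussDiagram ι} {a b : SignedArrow ι} {ε δ : ℤˣ}
    (ha : a ∉ D.arrows) (hb : b ∉ D.arrows) (h : D'.arrows = insert a (insert b D.arrows))
    (hsign : b.sign = -a.sign) (htail : D'.Neighbours ε a.tail b.tail)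
    (hhead : D'.Neighbours δ a.head b.head) : SameInvariants D D' := by
  classical
  have ha' : a ∈ D'.arrows := h ▸ Finset.mem_insert_self _ _
  have hb' : b ∈ D'.arrows := h ▸ Finset.mem_insert_of_mem (Finset.mem_insert_self _ _)
  have hD : ∀ c ∈ D.arrows, c ∈ D'.arrows ∧ c ≠ a ∧ c ≠ b := fun c hc =>
    ⟨h ▸ Finset.mem_insert_of_mem (Finset.mem_insert_of_mem hc), fun e => ha (e ▸ hc),
      fun e => hb (e ▸ hc)⟩
  have hab : a ∉ insert b D.arrows := by
    rw [Finset.mem_insert, not_or]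
    exact ⟨fun e => htail.ne (e ▸ rfl), ha⟩
  have hself : ∀ i, b.IsSelf i ↔ a.IsSelf i := fun i => by
    unfold IsSelf
    rw [htail.fst_eq, hhead.fst_eq]
  have hsgn : (b.sign : ℤ) = -a.sign := by rw [hsign, Units.val_neg]
  refine ⟨1, fun i j hij => ?_, fun i k hk => ?_⟩
  · change D'.overLk i j = _
    rw [overLk, overLk, h, Finset.sum_insert hab, Finset.sum_insert hb, ← htail.fst_eq,
      ← hhead.fst_eq, hsgn, ← add_assoc, add_eq_right]
    split_ifs <;> simp
  · have hidx : ∀ c ∈ D.arrows, c.IsSelf i → D'.selfIndex i c = D.selfIndex i c := by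
      intro c hc hci
      rw [selfIndex, selfIndex, h, Finset.sum_insert hab, Finset.sum_insert hb, ← add_assoc,
        add_eq_right, if_congr (hself i) rfl rfl]
      split_ifs with hai
      · exact htail.chordTerm_add_chordTerm hhead hsign ha' hb' (hD c hc).1 (hD c hc).2.1
          (hD c hc).2.2 hai hci
      · rfl
    have hidxa : a.IsSelf i → D'.selfIndex i a = D'.selfIndex i b := by
      intro hai
      unfold selfIndex
      rw [h, Finset.sum_insert hab, Finset.sum_insert hb, Finset.sum_insert hab,
        Finset.sum_insert hb, if_pos hai, if_pos ((hself i).2 hai), if_pos hai,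
        if_pos ((hself i).2 hai), chordTerm_self, chordTerm_self,
        htail.chordTerm_comm hhead hsign ha' hb' hai]
      have : ∀ c ∈ D.arrows, (if c.IsSelf i then a.chordTerm c else 0) =
          if c.IsSelf i then b.chordTerm c else 0 := by
        intro c hc
        split_ifs with hci
        · exact htail.chordTerm_congr hhead ha' hb' (hD c hc).1 (hD c hc).2.1
            (hD c hc).2.2 hai hci
        · rfl
      rw [Finset.sum_congr rfl this]
      ring
    change D'.selfWrithe i k = _
    have hiff : (b.IsSelf i ∧ D'.selfIndex i b = k) ↔ (a.IsSelf i ∧ D'.selfIndex i a = k) := by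
      rw [hself]
      exact and_congr_right_iff.2 fun hai => by rw [hidxa hai]
    rw [selfWrithe, h, Finset.sum_insert hab, Finset.sum_insert hb, if_congr hiff rfl rfl, hsgn,
      ← add_assoc]
    have h0 : ∀ c ∈ D.arrows, (if c.IsSelf i ∧ D'.selfIndex i c = k then (c.sign : ℤ) else 0) =
        if c.IsSelf i ∧ D.selfIndex i c = k then (c.sign : ℤ) else 0 := fun c hc =>
      if_congr (and_congr_right_iff.2 fun hci => by rw [hidx c hc hci]) rfl rfl
    rw [Finset.sum_congr rfl h0, selfWrithe, add_eq_right]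
    split_ifs <;> simp

/-! ### Invariance under RIII, by swapping neighbours. -/

/-- `τ` interchanges some pairs of neighbours, and fixes the other end points. -/
structure IsNeighbourSwap (D : GaussDiagram ι) (τ : Equiv.Perm (CirclePoint ι)) : Prop where
  involutive : ∀ x, τ (τ x) = x
  isEndpoint : ∀ x, D.IsEndpoint x → D.IsEndpoint (τ x)
  neighbours : ∀ x, D.IsEndpoint x → τ x ≠ x → ∃ ε, D.Neighbours ε x (τ x)

namespace IsNeighbourSwap

variable {D : GaussDiagram ι} {τ : Equiv.Perm (CirclePoint ι)} {p q x : CirclePoint ι} {ε : ℤˣ}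

theorem fst_eq (hτ : D.IsNeighbourSwap τ) (hx : D.IsEndpoint x) : (τ x).1 = x.1 := by
  by_cases h : τ x = x
  · rw [h]
  · obtain ⟨ε, h⟩ := hτ.neighbours x hx h
    exact h.fst_eq.symm

theorem ne_comm (hτ : D.IsNeighbourSwap τ) (h : x ≠ τ p) : p ≠ τ x :=
  fun e => h (by rw [e, hτ.involutive])

/-- The three points are replaced by their images one at a time. Each replacement is invisible
because the hypotheses keep any two of the points from being partners under `τ`. -/
theorem arcIndicator_eq (hτ : D.IsNeighbourSwap τ) (hp : D.IsEndpoint p) (hq : D.IsEndpoint q)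
    (hx : D.IsEndpoint x) (hpq : p.1 = q.1) (hxq : x.1 = q.1) (h1 : p ≠ q) (h2 : x ≠ p)
    (h3 : x ≠ q) (h4 : p ≠ τ q) (h5 : x ≠ τ p) (h6 : x ≠ τ q) :
    arcIndicator (τ p).2 (τ q).2 (τ x).2 = arcIndicator p.2 q.2 x.2 := by
  have e1 : arcIndicator p.2 q.2 x.2 = arcIndicator (τ p).2 q.2 x.2 := by
    by_cases h : τ p = p
    · rw [h]
    · obtain ⟨ε, h⟩ := hτ.neighbours p hp h
      rw [h.arcIndicator_congr_left hq hx hpq.symm (hxq.trans hpq.symm) h1.symm (hτ.ne_comm h4)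
        h2 h5]
  have e2 : arcIndicator (τ p).2 q.2 x.2 = arcIndicator (τ p).2 (τ q).2 x.2 := by
    by_cases h : τ q = q
    · rw [h]
    · obtain ⟨ε, h⟩ := hτ.neighbours q hq h
      rw [h.arcIndicator_congr_right hx (hτ.isEndpoint p hp) hxq ((hτ.fst_eq hp).trans hpq) h3 h6
        (hτ.ne_comm h4).symm (fun e => h1 (τ.injective e))]
  have e3 : arcIndicator (τ p).2 (τ q).2 x.2 = arcIndicator (τ p).2 (τ q).2 (τ x).2 := by
    by_cases h : τ x = x
    · rw [h]
    · obtain ⟨ε, h⟩ := hτ.neighbours x hx h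
      rw [h.arcIndicator_congr (hτ.isEndpoint p hp) (hτ.isEndpoint q hq)
        ((hτ.fst_eq hp).trans (hpq.trans hxq.symm)) ((hτ.fst_eq hq).trans hxq.symm) h5.symm
        (fun e => h2 (τ.injective e.symm)) h6.symm (fun e => h3 (τ.injective e.symm))]
  rw [e1, e2, e3]

/-- The tested point is the partner of the initial point of the arc. The swap carries it across that
end, and the indicator goes from (1 + ε)/2 to (1 - ε)/2. At the terminal point, treated next, the
jump is opposite. -/
theorem arcIndicator_left (hτ : D.IsNeighbourSwap τ) (hq : D.IsEndpoint q)
    (hpq : p.1 = q.1) (h1 : p ≠ q) (h4 : p ≠ τ q) (hε : D.Neighbours ε p (τ p)) :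
    arcIndicator (τ p).2 (τ q).2 p.2 = arcIndicator p.2 q.2 (τ p).2 - ε := by
  have e1 := hε.two_mul_arcIndicator_left hq hpq.symm h1.symm (hτ.ne_comm h4)
  have e2 := hε.symm.two_mul_arcIndicator_left (hτ.isEndpoint q hq)
    ((hτ.fst_eq hq).trans (hpq.symm.trans hε.fst_eq)) (fun e => h1 (τ.injective e.symm)) h4.symm
  rw [Units.val_neg] at e2
  omega

theorem arcIndicator_right (hτ : D.IsNeighbourSwap τ) (hp : D.IsEndpoint p)
    (hpq : p.1 = q.1) (h1 : p ≠ q) (h4 : p ≠ τ q) (hε : D.Neighbours ε q (τ q)) :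
    arcIndicator (τ p).2 (τ q).2 q.2 = arcIndicator p.2 q.2 (τ q).2 + ε := by
  have e1 := hε.two_mul_arcIndicator_right hp hpq h1 h4
  have e2 := hε.symm.two_mul_arcIndicator_right (hτ.isEndpoint p hp)
    ((hτ.fst_eq hp).trans (hpq.trans hε.fst_eq)) (fun e => h1 (τ.injective e))
    (hτ.ne_comm h4).symm
  rw [Units.val_neg] at e2
  omega

end IsNeighbourSwap

namespace IsNeighbourSwap

variable {D : GaussDiagram ι} {τ : Equiv.Perm (CirclePoint ι)} {x y : SignedArrow ι} {i : ι}
  {ε : ℤˣ}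

theorem arcIndicator_chord (hτ : D.IsNeighbourSwap τ) (hx : x ∈ D.arrows) (hxi : x.IsSelf i)
    (hx' : x.tail ≠ τ x.head) {p : CirclePoint ι} (hp : D.IsEndpoint p) (hpi : p.1 = i)
    (h1 : p ≠ x.tail) (h2 : p ≠ x.head) (h3 : p ≠ τ x.tail) (h4 : p ≠ τ x.head) :
    arcIndicator (τ x.tail).2 (τ x.head).2 (τ p).2 = arcIndicator x.tail.2 x.head.2 p.2 :=
  hτ.arcIndicator_eq (isEndpoint_tail hx) (isEndpoint_head hx) hp (hxi.1.trans hxi.2.symm)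
    (hpi.trans hxi.2.symm) (D.tail_ne_head x hx x hx) h1 h2 hx' h3 h4

theorem chordTerm_eq (hτ : D.IsNeighbourSwap τ) (hx : x ∈ D.arrows) (hy : y ∈ D.arrows)
    (hxi : x.IsSelf i) (hyi : y.IsSelf i) (hyx : y ≠ x) (hx' : x.tail ≠ τ x.head)
    (h1 : y.tail ≠ τ x.tail) (h2 : y.tail ≠ τ x.head) (h3 : y.head ≠ τ x.tail)
    (h4 : y.head ≠ τ x.head) : (x.map τ).chordTerm (y.map τ) = x.chordTerm y := by
  simp only [chordTerm, SignedArrow.map]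
  rw [hτ.arcIndicator_chord hx hxi hx' (isEndpoint_tail hy) hyi.1 (D.tail_ne_tail hy hx hyx)
      (D.tail_ne_head y hy x hx) h1 h2,
    hτ.arcIndicator_chord hx hxi hx' (isEndpoint_head hy) hyi.2
      (D.tail_ne_head x hx y hy).symm (D.head_ne_head hy hx hyx) h3 h4]

/-- In this and the next three lemmas one end of `y` is the partner of one end of `x`; the name
gives the end of `y` first. The arc indicator jumps by -ε at the tail of `x` and by +ε at its head,
and the head of `y` counts negatively; hence minus for like ends and plus for unlike ones. -/
theorem chordTerm_tail_tail (hτ : D.IsNeighbourSwap τ) (hx : x ∈ D.arrows) (hy : y ∈ D.arrows)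
    (hxi : x.IsSelf i) (hyi : y.IsSelf i) (hyx : y ≠ x) (hx' : x.tail ≠ τ x.head)
    (h1 : y.tail = τ x.tail) (h3 : y.head ≠ τ x.tail)
    (h4 : y.head ≠ τ x.head) (hε : D.Neighbours ε x.tail y.tail) :
    (x.map τ).chordTerm (y.map τ) = x.chordTerm y - y.sign * ε := by
  simp only [chordTerm, SignedArrow.map]
  rw [hτ.arcIndicator_chord hx hxi hx' (isEndpoint_head hy) hyi.2
      (D.tail_ne_head x hx y hy).symm (D.head_ne_head hy hx hyx) h3 h4, h1, hτ.involutive,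
      hτ.arcIndicator_left (isEndpoint_head hx) (hxi.1.trans hxi.2.symm)
        (D.tail_ne_head x hx x hx) hx' (h1 ▸ hε)]
  ring

theorem chordTerm_head_head (hτ : D.IsNeighbourSwap τ) (hx : x ∈ D.arrows) (hy : y ∈ D.arrows)
    (hxi : x.IsSelf i) (hyi : y.IsSelf i) (hyx : y ≠ x) (hx' : x.tail ≠ τ x.head)
    (h1 : y.tail ≠ τ x.tail) (h2 : y.tail ≠ τ x.head)
    (h4 : y.head = τ x.head) (hε : D.Neighbours ε x.head y.head) :
    (x.map τ).chordTerm (y.map τ) = x.chordTerm y - y.sign * ε := by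
  simp only [chordTerm, SignedArrow.map]
  rw [hτ.arcIndicator_chord hx hxi hx' (isEndpoint_tail hy) hyi.1 (D.tail_ne_tail hy hx hyx)
      (D.tail_ne_head y hy x hx) h1 h2, h4, hτ.involutive,
      hτ.arcIndicator_right (isEndpoint_tail hx) (hxi.1.trans hxi.2.symm)
        (D.tail_ne_head x hx x hx) hx' (h4 ▸ hε)]
  ring

theorem chordTerm_tail_head (hτ : D.IsNeighbourSwap τ) (hx : x ∈ D.arrows) (hy : y ∈ D.arrows)
    (hxi : x.IsSelf i) (hyi : y.IsSelf i) (hyx : y ≠ x) (hx' : x.tail ≠ τ x.head)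
    (h2 : y.tail = τ x.head) (h3 : y.head ≠ τ x.tail)
    (h4 : y.head ≠ τ x.head) (hε : D.Neighbours ε x.head y.tail) :
    (x.map τ).chordTerm (y.map τ) = x.chordTerm y + y.sign * ε := by
  simp only [chordTerm, SignedArrow.map]
  rw [hτ.arcIndicator_chord hx hxi hx' (isEndpoint_head hy) hyi.2
      (D.tail_ne_head x hx y hy).symm (D.head_ne_head hy hx hyx) h3 h4, h2, hτ.involutive,
      hτ.arcIndicator_right (isEndpoint_tail hx) (hxi.1.trans hxi.2.symm)
        (D.tail_ne_head x hx x hx) hx' (h2 ▸ hε)]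
  ring

theorem chordTerm_head_tail (hτ : D.IsNeighbourSwap τ) (hx : x ∈ D.arrows) (hy : y ∈ D.arrows)
    (hxi : x.IsSelf i) (hyi : y.IsSelf i) (hyx : y ≠ x) (hx' : x.tail ≠ τ x.head)
    (h1 : y.tail ≠ τ x.tail) (h2 : y.tail ≠ τ x.head)
    (h3 : y.head = τ x.tail) (hε : D.Neighbours ε x.tail y.head) :
    (x.map τ).chordTerm (y.map τ) = x.chordTerm y + y.sign * ε := by
  simp only [chordTerm, SignedArrow.map]
  rw [hτ.arcIndicator_chord hx hxi hx' (isEndpoint_tail hy) hyi.1 (D.tail_ne_tail hy hx hyx)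
      (D.tail_ne_head y hy x hx) h1 h2, h3, hτ.involutive,
      hτ.arcIndicator_left (isEndpoint_head hx) (hxi.1.trans hxi.2.symm)
        (D.tail_ne_head x hx x hx) hx' (h3 ▸ hε)]
  ring

end IsNeighbourSwap

/-- The move is the image of the diagram under a swap of three pairs of neighbours. A chord outside
the triangle shares no pair with another chord, so its index is unaffected. The index of a triangle
chord receives one jump from each of the other two, and the sign conditions say precisely that these
jumps cancel. -/
theorem sameInvariants_r3 {D D' : GaussDiagram ι} {a b c : SignedArrow ι} {t m s : ℤˣ}
    (ha : a ∈ D.arrows) (hb : b ∈ D.arrows) (hc : c ∈ D.arrows)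
    (hab : a ≠ b) (hac : a ≠ c) (hbc : b ≠ c)
    (htop : D.Neighbours t a.tail b.tail)
    (hmid : D.Neighbours m a.head c.tail)
    (hbot : D.Neighbours s b.head c.head)
    (hsign₁ : a.sign * (t * m) = b.sign * (t * s))
    (hsign₂ : b.sign * (t * s) = c.sign * (m * s))
    (h : D'.arrows = (D.arrows \ {a, b, c}) ∪
      {⟨b.tail, c.tail, a.sign⟩, ⟨a.tail, c.head, b.sign⟩, ⟨a.head, b.head, c.sign⟩}) :
    SameInvariants D D' := by
  classical
  -- the six end points of the triangle are distinct
  have n1 := D.tail_ne_tail ha hb hab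
  have n2 := D.tail_ne_tail ha hc hac
  have n3 := D.tail_ne_tail hb hc hbc
  have n4 := D.head_ne_head ha hb hab
  have n5 := D.head_ne_head ha hc hac
  have n6 := D.head_ne_head hb hc hbc
  have maa := D.tail_ne_head a ha a ha
  have mab := D.tail_ne_head a ha b hb
  have mac := D.tail_ne_head a ha c hc
  have mba := D.tail_ne_head b hb a ha
  have mbb := D.tail_ne_head b hb b hb
  have mbc := D.tail_ne_head b hb c hc
  have mca := D.tail_ne_head c hc a ha
  have mcb := D.tail_ne_head c hc b hb
  have mcc := D.tail_ne_head c hc c hc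
  -- The transpositions are disjoint, since the six end points are distinct.
  obtain ⟨τ, hτdef⟩ : ∃ τ : Equiv.Perm (CirclePoint ι), τ =
    Equiv.swap a.tail b.tail * Equiv.swap a.head c.tail * Equiv.swap b.head c.head := ⟨_, rfl⟩
  have t1 : τ a.tail = b.tail := by
    simp [Equiv.swap_apply_of_ne_of_ne, *]
  have t2 : τ b.tail = a.tail := by
    simp [Equiv.swap_apply_of_ne_of_ne, *]
  have t3 : τ a.head = c.tail := by
    simp [Equiv.swap_apply_of_ne_of_ne, *, n2.symm, n3.symm]
  have t4 : τ c.tail = a.head := by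
    simp [Equiv.swap_apply_of_ne_of_ne, *, maa.symm, mba.symm]
  have t5 : τ b.head = c.head := by
    simp [Equiv.swap_apply_of_ne_of_ne, *, n5.symm, mac.symm, mbc.symm, mcc.symm]
  have t6 : τ c.head = b.head := by
    simp [Equiv.swap_apply_of_ne_of_ne, *, n4.symm, mab.symm, mbb.symm, mcb.symm]
  have tfix : ∀ x, x ≠ a.tail → x ≠ b.tail → x ≠ a.head → x ≠ c.tail → x ≠ b.head →
      x ≠ c.head → τ x = x := by
    intro x h1 h2 h3 h4 h5 h6
    simp [Equiv.swap_apply_of_ne_of_ne, *]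
  have tarrow : ∀ d ∈ D.arrows, d ≠ a → d ≠ b → d ≠ c → τ d.tail = d.tail ∧ τ d.head = d.head := by
    intro d hd h1 h2 h3
    exact ⟨tfix _ (D.tail_ne_tail hd ha h1) (D.tail_ne_tail hd hb h2) (D.tail_ne_head d hd a ha)
      (D.tail_ne_tail hd hc h3) (D.tail_ne_head d hd b hb) (D.tail_ne_head d hd c hc),
      tfix _ (D.tail_ne_head a ha d hd).symm (D.tail_ne_head b hb d hd).symm
      (D.head_ne_head hd ha h1) (D.tail_ne_head c hc d hd).symm (D.head_ne_head hd hb h2)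
      (D.head_ne_head hd hc h3)⟩
  have hτ : D.IsNeighbourSwap τ := by
    have hcase : ∀ x, x = a.tail ∨ x = b.tail ∨ x = a.head ∨ x = c.tail ∨ x = b.head ∨
        x = c.head ∨ τ x = x := by
      intro x
      by_contra! hx
      obtain ⟨h1, h2, h3, h4, h5, h6, h7⟩ := hx
      exact h7 (tfix x h1 h2 h3 h4 h5 h6)
    refine ⟨fun x => ?_, fun x hx => ?_, fun x hx hne => ?_⟩
    · rcases hcase x with rfl | rfl | rfl | rfl | rfl | rfl | hx
      · rw [t1, t2]
      · rw [t2, t1]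
      · rw [t3, t4]
      · rw [t4, t3]
      · rw [t5, t6]
      · rw [t6, t5]
      · rw [hx, hx]
    · rcases hcase x with rfl | rfl | rfl | rfl | rfl | rfl | hx'
      · rw [t1]; exact isEndpoint_tail hb
      · rw [t2]; exact isEndpoint_tail ha
      · rw [t3]; exact isEndpoint_tail hc
      · rw [t4]; exact isEndpoint_head ha
      · rw [t5]; exact isEndpoint_head hc
      · rw [t6]; exact isEndpoint_head hb
      · rwa [hx']
    · rcases hcase x with rfl | rfl | rfl | rfl | rfl | rfl | hx'
      · rw [t1]; exact ⟨_, htop⟩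
      · rw [t2]; exact ⟨_, htop.symm⟩
      · rw [t3]; exact ⟨_, hmid⟩
      · rw [t4]; exact ⟨_, hmid.symm⟩
      · rw [t5]; exact ⟨_, hbot⟩
      · rw [t6]; exact ⟨_, hbot.symm⟩
      · exact absurd hx' hne
  have hsub : ({a, b, c} : Finset (SignedArrow ι)) ⊆ D.arrows := by
    intro x hx
    simp only [Finset.mem_insert, Finset.mem_singleton] at hx
    rcases hx with rfl | rfl | rfl <;> assumption
  have himage : D'.arrows = D.arrows.image (SignedArrow.map τ) := by
    have e : D.arrows = (D.arrows \ {a, b, c}) ∪ {a, b, c} :=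
      (Finset.sdiff_union_of_subset hsub).symm
    rw [e, Finset.image_union, h]
    congr 1
    · have : ∀ d ∈ D.arrows \ {a, b, c}, SignedArrow.map τ d = id d := by
        intro d hd
        simp only [Finset.mem_sdiff, Finset.mem_insert, Finset.mem_singleton, not_or] at hd
        obtain ⟨h1, h2⟩ := tarrow d hd.1 hd.2.1 hd.2.2.1 hd.2.2.2
        exact SignedArrow.ext h1 h2 rfl
      rw [Finset.image_congr this, Finset.image_id]
    · simp only [Finset.image_insert, Finset.image_singleton, SignedArrow.map, t1, t2, t3, t4, t5,
        t6]
  -- signs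
  have s1 : (b.sign : ℤ) * t = c.sign * m := by
    rw [← mul_assoc, ← mul_assoc] at hsign₂
    exact_mod_cast congrArg Units.val (mul_right_cancel hsign₂)
  have s2 : (a.sign : ℤ) * t = c.sign * s := by
    have := hsign₁.trans hsign₂
    rw [mul_comm m s, ← mul_assoc, ← mul_assoc] at this
    exact_mod_cast congrArg Units.val (mul_right_cancel this)
  have s3 : (a.sign : ℤ) * m = b.sign * s := by
    rw [mul_comm t m, mul_comm t s, ← mul_assoc, ← mul_assoc] at hsign₁
    exact_mod_cast congrArg Units.val (mul_right_cancel hsign₁)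
  have f1 := htop.fst_eq
  have f2 := hmid.fst_eq
  have f3 := hbot.fst_eq
  refine sameInvariants_of_image 1 τ.injective himage (fun x hx => hτ.fst_eq hx)
    fun i x hx hxi => ?_
  rw [← sub_eq_zero, selfIndex, ← Finset.sum_sub_distrib]
  -- only the arrows of the triangle can contribute
  have hred : ∀ y ∈ D.arrows, y ∉ ({a, b, c} : Finset (SignedArrow ι)) →
      ((if y.IsSelf i then (x.map τ).chordTerm (y.map τ) else 0) -
        if y.IsSelf i then x.chordTerm y else 0) = 0 := by
    intro y hy hyn
    simp only [Finset.mem_insert, Finset.mem_singleton, not_or] at hyn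
    split_ifs with hyi
    · by_cases hyx : y = x
      · rw [hyx, chordTerm_self, chordTerm_self, sub_self]
      · obtain ⟨h1, h2⟩ := tarrow y hy hyn.1 hyn.2.1 hyn.2.2
        have hx' : x.tail ≠ τ x.head := by
          intro e
          by_cases hxa : x = a
          · subst hxa; exact n2 (e.trans t3)
          by_cases hxb : x = b
          · subst hxb; exact mbc (e.trans t5)
          by_cases hxc : x = c
          · subst hxc; exact mcb (e.trans t6)
          rw [(tarrow x hx hxa hxb hxc).2] at e
          exact D.tail_ne_head x hx x hx e
        rw [hτ.chordTerm_eq hx hy hxi hyi hyx hx', sub_self]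
        · intro e
          exact D.tail_ne_tail hy hx hyx (τ.injective (h1.trans e))
        · intro e
          exact D.tail_ne_head y hy x hx (τ.injective (h1.trans e))
        · intro e
          exact (D.tail_ne_head x hx y hy).symm (τ.injective (h2.trans e))
        · intro e
          exact D.head_ne_head hy hx hyx (τ.injective (h2.trans e))
    · rw [sub_self]
  by_cases hxn : x ∈ ({a, b, c} : Finset (SignedArrow ι))
  · rw [← Finset.sum_subset hsub hred,
      Finset.sum_insert (by simp [hab, hac]), Finset.sum_insert (by simp [hbc]),
      Finset.sum_singleton]
    simp only [Finset.mem_insert, Finset.mem_singleton] at hxn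
    rcases hxn with rfl | rfl | rfl
    · rw [chordTerm_self, chordTerm_self]
      -- With `a` on the circle `i`, the tails of `b` and `c` lie there too, and their heads share a
      -- circle. So both jumps occur or neither does, and `s1` cancels them; `s2` and `s3` do this
      -- for the chords `b` and `c`.
      have hiff : b.IsSelf i ↔ c.IsSelf i := by
        unfold IsSelf; rw [← f1, ← f2, f3, hxi.1, hxi.2]
      by_cases hci : c.IsSelf i
      · have hbi := hiff.2 hci
        rw [if_pos hbi, if_pos hbi, if_pos hci, if_pos hci,
          hτ.chordTerm_tail_tail hx hb hxi hbi hab.symm (by rwa [t3]) t1.symm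
            (by rw [t1]; exact mbb.symm) (by rw [t3]; exact mcb.symm) htop,
          hτ.chordTerm_tail_head hx hc hxi hci hac.symm (by rwa [t3]) t3.symm
            (by rw [t1]; exact mbc.symm) (by rw [t3]; exact mcc.symm) hmid, s1]
        simp
      · have hbi : ¬ b.IsSelf i := fun h => hci (hiff.1 h)
        simp [if_neg hbi, if_neg hci]
    · rw [chordTerm_self, chordTerm_self]
      have hiff : a.IsSelf i ↔ c.IsSelf i := by
        unfold IsSelf; rw [f1, ← f2, ← f3, hxi.1, hxi.2]; tauto
      by_cases hci : c.IsSelf i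
      · have hai := hiff.2 hci
        rw [if_pos hai, if_pos hai, if_pos hci, if_pos hci,
          hτ.chordTerm_tail_tail hx ha hxi hai hab (by rwa [t5]) t2.symm
            (by rw [t2]; exact maa.symm) (by rwa [t5]) htop.symm,
          hτ.chordTerm_head_head hx hc hxi hci hbc.symm (by rwa [t5]) (by rw [t2]; exact n2.symm)
            (by rwa [t5]) t5.symm hbot, Units.val_neg, mul_neg, s2]
        simp
      · have hai : ¬ a.IsSelf i := fun h => hci (hiff.1 h)
        simp [if_neg hai, if_neg hci]
    · rw [chordTerm_self, chordTerm_self]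
      have hiff : a.IsSelf i ↔ b.IsSelf i := by
        unfold IsSelf; rw [f1, f2, f3, hxi.1, hxi.2]
      by_cases hbi : b.IsSelf i
      · have hai := hiff.2 hbi
        rw [if_pos hai, if_pos hai, if_pos hbi, if_pos hbi,
          hτ.chordTerm_head_tail hx ha hxi hai hac (by rwa [t6]) (by rwa [t4]) (by rwa [t6])
            t4.symm hmid.symm,
          hτ.chordTerm_head_head hx hb hxi hbi hbc (by rwa [t6]) (by rwa [t4])
            (by rwa [t6]) t6.symm hbot.symm, Units.val_neg, Units.val_neg, mul_neg, mul_neg, s3]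
        simp
      · have hai : ¬ a.IsSelf i := fun h => hbi (hiff.1 h)
        simp [if_neg hai, if_neg hbi]
  · refine Finset.sum_eq_zero fun y hy => ?_
    by_cases hyn : y ∈ ({a, b, c} : Finset (SignedArrow ι))
    · have hyx : y ≠ x := fun e => hxn (e ▸ hyn)
      simp only [Finset.mem_insert, Finset.mem_singleton, not_or] at hxn
      obtain ⟨h1, h2⟩ := tarrow x hx hxn.1 hxn.2.1 hxn.2.2
      split_ifs with hyi
      · rw [hτ.chordTerm_eq hx hy hxi hyi hyx, sub_self]
        · rw [h2]; exact D.tail_ne_head x hx x hx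
        · rw [h1]; exact D.tail_ne_tail hy hx hyx
        · rw [h2]; exact D.tail_ne_head y hy x hx
        · rw [h1]; exact (D.tail_ne_head x hx y hy).symm
        · rw [h2]; exact D.head_ne_head hy hx hyx
      · rw [sub_self]
    · exact hred y hy hyn

theorem sameInvariants_of_equiv {D D' : GaussDiagram ι} (h : (setoid ι).r D D') :
    SameInvariants D D' := by
  induction h with
  | rel D D' h =>
    cases h with
    | isotopy σ φ hφ h => exact sameInvariants_isotopy σ φ hφ h
    | r1 a ε ha h harc => exact sameInvariants_r1 ha h harc
    | r2 a b ε δ ha hb h hsign ht hh => exact sameInvariants_r2 ha hb h hsign ht hh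
    | r3 a b c t m s ha hb hc hab hac hbc ht hm hb' h1 h2 h =>
      exact sameInvariants_r3 ha hb hc hab hac hbc ht hm hb' h1 h2 h
  | refl D => exact SameInvariants.refl D
  | symm _ _ _ ih => exact ih.symm
  | trans _ _ _ _ _ ih ih' => exact ih.trans ih'

/-! ### Span, linking number and `ell` -/

theorem wriggle_eq_overLk_sub (D : GaussDiagram ι) (i j : ι) :
    D.wriggle i j = D.overLk i j - D.overLk j i := by
  have h1 := D.overCount_sub i j
  have h2 := D.overCount_sub j i
  unfold wriggle overLk
  linarith

theorem overLk_virtualize (D : GaussDiagram ι) {S : Finset (SignedArrow ι)} (hS : S ⊆ D.arrows)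
    (i j : ι) : (D.virtualize S).overLk i j = D.overLk i j -
      open Classical in ∑ a ∈ S, if a.tail.1 = i ∧ a.head.1 = j then (a.sign : ℤ) else 0 :=
  Finset.sum_sdiff_eq_sub hS

theorem virtualize_insert (D : GaussDiagram ι) (a : SignedArrow ι) (S : Finset (SignedArrow ι)) :
    D.virtualize (insert a S) = (D.virtualize {a}).virtualize S := by
  apply GaussDiagram.ext
  ext x
  simp [virtualize, and_assoc]

theorem exists_sign_eq (D : GaussDiagram ι) {i j : ι} {ε : ℤˣ} (h : 0 < ε * D.overLk i j) :
    ∃ a ∈ D.arrows, a.tail.1 = i ∧ a.head.1 = j ∧ a.sign = ε := by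
  classical
  by_contra! hcon
  refine absurd h (not_lt.2 ?_)
  rw [overLk, Finset.mul_sum]
  refine Finset.sum_nonpos fun a ha => ?_
  split_ifs with hij
  · have h1 := hcon a ha hij.1 hij.2
    rcases Int.units_eq_one_or a.sign with h2 | h2 <;>
      rcases Int.units_eq_one_or ε with h3 | h3 <;> simp_all
  · simp

/-- The distance of `0` from the interval between `r` and `l`. -/
def ellBound (r l : ℤ) : ℤ := max 0 (max (min r l) (min (-r) (-l)))

theorem overLk_virtualize_singleton (D : GaussDiagram ι) {a : SignedArrow ι} (ha : a ∈ D.arrows)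
    (i j : ι) : (D.virtualize {a}).overLk i j = D.overLk i j -
      open Classical in if a.tail.1 = i ∧ a.head.1 = j then (a.sign : ℤ) else 0 := by
  rw [D.overLk_virtualize (Finset.singleton_subset_iff.2 ha), Finset.sum_singleton]

/-- Greedy deletion: each step moves one end of the interval between the two linking numbers a unit
inward without losing the point nearest to 0. When the interval has shrunk to a point, that point
has absolute value at most the original distance from 0. -/
theorem exists_virtualization (n : ℕ) : ∀ (D : GaussDiagram ι) {p q : ι}, p ≠ q →
    (D.overLk p q - D.overLk q p).natAbs = n → ∃ S ⊆ D.arrows, S.card = n ∧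
      (D.virtualize S).overLk p q = (D.virtualize S).overLk q p ∧
      |(D.virtualize S).overLk p q| ≤ ellBound (D.overLk p q) (D.overLk q p) := by
  classical
  induction n with
  | zero =>
    intro D p q _ h
    refine ⟨∅, Finset.empty_subset _, rfl, ?_⟩
    have : D.virtualize ∅ = D := GaussDiagram.ext (by simp [virtualize])
    rw [this, abs_le]
    unfold ellBound
    omega
  | succ n ih =>
    intro D p q hpq h
    -- a crossing whose removal brings the linking numbers closer together
    have hstep : ∃ a ∈ D.arrows,
        ((D.virtualize {a}).overLk p q - (D.virtualize {a}).overLk q p).natAbs = n ∧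
        ellBound ((D.virtualize {a}).overLk p q) ((D.virtualize {a}).overLk q p) ≤
          ellBound (D.overLk p q) (D.overLk q p) := by
      have hqp := hpq.symm
      rcases lt_or_ge (D.overLk q p) (D.overLk p q) with hlt | hge
      -- The larger end is lowered if it is positive; otherwise the smaller end, which is then
      -- negative, is raised. In either case the distance from 0 does not grow.
      · by_cases hp : 0 < D.overLk p q
        · obtain ⟨a, ha, h1, h2, h3⟩ := D.exists_sign_eq (i := p) (j := q) (ε := 1) (by simpa)
          refine ⟨a, ha, ?_⟩
          rw [D.overLk_virtualize_singleton ha, D.overLk_virtualize_singleton ha]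
          simp only [h1, h2, h3, hpq, hqp, and_self, if_true, if_false, Units.val_one, ellBound]
          omega
        · obtain ⟨a, ha, h1, h2, h3⟩ := D.exists_sign_eq (i := q) (j := p) (ε := -1)
            (by simp; omega)
          refine ⟨a, ha, ?_⟩
          rw [D.overLk_virtualize_singleton ha, D.overLk_virtualize_singleton ha]
          simp only [h1, h2, h3, hpq, hqp, and_self, if_true, if_false, Units.val_neg,
            Units.val_one, ellBound]
          omega
      · by_cases hp : 0 < D.overLk q p
        · obtain ⟨a, ha, h1, h2, h3⟩ := D.exists_sign_eq (i := q) (j := p) (ε := 1) (by simpa)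
          refine ⟨a, ha, ?_⟩
          rw [D.overLk_virtualize_singleton ha, D.overLk_virtualize_singleton ha]
          simp only [h1, h2, h3, hpq, hqp, and_self, if_true, if_false, Units.val_one, ellBound]
          omega
        · obtain ⟨a, ha, h1, h2, h3⟩ := D.exists_sign_eq (i := p) (j := q) (ε := -1)
            (by simp; omega)
          refine ⟨a, ha, ?_⟩
          rw [D.overLk_virtualize_singleton ha, D.overLk_virtualize_singleton ha]
          simp only [h1, h2, h3, hpq, hqp, and_self, if_true, if_false, Units.val_neg,
            Units.val_one, ellBound]
          omega
    obtain ⟨a, ha, hn, hle⟩ := hstep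
    obtain ⟨S, hS, hc, h1, h2⟩ := ih _ hpq hn
    have haS : a ∉ S := fun h => by
      have := hS h
      simp [virtualize] at this
    rw [← virtualize_insert] at h1 h2
    exact ⟨insert a S, Finset.insert_subset ha (hS.trans Finset.sdiff_subset),
      by rw [Finset.card_insert_of_notMem haS, hc], h1, h2.trans hle⟩

theorem span_eq_of_pair [Fintype ι] [LinearOrder ι] (D : GaussDiagram ι) {p q : ι} (hpq : p < q)
    (h : ∀ x, x = p ∨ x = q) : D.span = (D.overLk p q - D.overLk q p).natAbs := by
  have : Finset.univ.filter (fun x : ι × ι => x.1 < x.2) = {(p, q)} := by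
    ext ⟨x, y⟩
    simp only [Finset.mem_filter, Finset.mem_univ, true_and, Finset.mem_singleton, Prod.mk.injEq]
    rcases h x with rfl | rfl <;> rcases h y with rfl | rfl <;>
      simp [hpq, hpq.ne, hpq.ne', hpq.not_gt]
  rw [span, this, Finset.sum_singleton, wriggle_eq_overLk_sub]

theorem lk_eq_of_pair (D : GaussDiagram ι) {p q : ι} (hpq : p ≠ q)
    (h : ∀ x, x = p ∨ x = q) : D.lk = (1 / 2) * ((D.overLk p q + D.overLk q p : ℤ) : ℚ) := by
  classical
  unfold lk overLk
  rw [← Finset.sum_add_distrib, Finset.sum_filter, Int.cast_sum]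
  congr 1
  refine Finset.sum_congr rfl fun a _ => ?_
  rcases h a.tail.1 with h1 | h1 <;> rcases h a.head.1 with h2 | h2 <;>
    simp [h1, h2, hpq, hpq.symm]

/-- Only an upper bound is needed, and `ell` is a minimum, so one good member of
`minimalVirtualizations` suffices. Its linking number is half the sum of two equal numbers, that is
their common value. -/
theorem ell_le_of_pair [Fintype ι] [LinearOrder ι] (D : GaussDiagram ι) {p q : ι} (hpq : p < q)
    (h : ∀ x, x = p ∨ x = q) : D.ell ≤ (ellBound (D.overLk p q) (D.overLk q p) : ℚ) := by
  obtain ⟨S, hS, hc, h1, h2⟩ := exists_virtualization _ D hpq.ne rfl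
  have hmem : S ∈ D.minimalVirtualizations := by
    refine Finset.mem_filter.2 ⟨Finset.mem_powerset.2 hS, ?_, ?_⟩
    · rw [hc, D.span_eq_of_pair hpq h]
    · rw [span_eq_of_pair _ hpq h, h1, sub_self, Int.natAbs_zero]
  refine (Finset.inf'_le _ hmem).trans ?_
  rw [lk_eq_of_pair _ hpq.ne h, ← h1, ← two_mul, Int.cast_mul, Int.cast_ofNat, ← mul_assoc,
    one_div_mul_cancel two_ne_zero, one_mul]
  exact_mod_cast h2

/-! ### Sublinks -/

/-- Transport of arrows from a sublink. -/
abbrev inclArrow (s : Finset ι) : SignedArrow s → SignedArrow ι :=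
  SignedArrow.map (Prod.map Subtype.val id)

/-- Passage to a sublink is reduced to restricting sums over arrows, which serves linking numbers,
indices and writhes alike. -/
theorem sum_sublink (D : GaussDiagram ι) (s : Finset ι) (f : SignedArrow ι → ℤ) :
    ∑ a ∈ (D.sublink s).arrows, f (inclArrow s a) =
      open Classical in ∑ a ∈ D.arrows, if a.tail.1 ∈ s ∧ a.head.1 ∈ s then f a else 0 := by
  classical
  rw [← Finset.sum_filter]
  unfold sublink
  rw [Finset.sum_preimage']
  refine Finset.sum_congr (Finset.filter_congr fun a _ => ?_) fun _ _ => rfl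
  constructor
  · rintro ⟨b, rfl⟩
    exact ⟨b.tail.1.2, b.head.1.2⟩
  · rintro ⟨h1, h2⟩
    exact ⟨⟨(⟨a.tail.1, h1⟩, a.tail.2), (⟨a.head.1, h2⟩, a.head.2), a.sign⟩, rfl⟩

theorem overLk_sublink (D : GaussDiagram ι) (s : Finset ι) (i j : s) :
    (D.sublink s).overLk i j = D.overLk i j := by
  classical
  have := D.sum_sublink s (fun a => if a.tail.1 = i ∧ a.head.1 = j then (a.sign : ℤ) else 0)
  unfold overLk
  refine (Finset.sum_congr rfl fun a _ => ?_).trans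
    (this.trans (Finset.sum_congr rfl fun a _ => ?_))
  · have : (a.tail.1 = i ∧ a.head.1 = j) ↔
        ((inclArrow s a).tail.1 = i ∧ (inclArrow s a).head.1 = j) :=
      and_congr Subtype.ext_iff Subtype.ext_iff
    by_cases h : a.tail.1 = i ∧ a.head.1 = j
    · rw [if_pos h, if_pos (this.1 h)]
      rfl
    · rw [if_neg h, if_neg (fun h' => h (this.2 h'))]
  · split_ifs with h1 h2 h2
    · rfl
    · rfl
    · exact absurd ⟨h2.1 ▸ i.2, h2.2 ▸ j.2⟩ h1
    · rfl

theorem ell_sublink_le [LinearOrder ι] (D : GaussDiagram ι) {i j : ι} (hij : i < j) :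
    (D.sublink {i, j}).ell ≤ (ellBound (D.overLk i j) (D.overLk j i) : ℚ) := by
  have hi : i ∈ ({i, j} : Finset ι) := by simp
  have hj : j ∈ ({i, j} : Finset ι) := by simp
  have := (D.sublink {i, j}).ell_le_of_pair (p := ⟨i, hi⟩) (q := ⟨j, hj⟩) hij (by
    rintro ⟨x, hx⟩
    simpa using hx)
  rwa [overLk_sublink, overLk_sublink] at this

/-- Away from its end points, the arcs cut off by a chord are complementary. -/
theorem sbtw_iff_not_sbtw_of_ne {α : Type*} [CircularOrder α] {p q x : α} (h1 : x ≠ p)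
    (h2 : x ≠ q) (h3 : p ≠ q) : sbtw q x p ↔ ¬ sbtw p x q :=
  ⟨fun h => sbtw_asymm h, fun h => (sbtw_or_sbtw_of_ne h1.symm h2 h3.symm).resolve_left h⟩

/-- A chord crosses `c` from right to left when its tail alone lies on the arc from the tail of `c`
to its head, and from left to right when its head alone does. The difference of the two indicators
records this as 1, -1 or 0. -/
theorem index_eq_sum [Unique ι] (D : GaussDiagram ι) {c : SignedArrow ι} (hc : c ∈ D.arrows) :
    D.index c = ∑ d ∈ D.arrows, c.chordTerm d := by
  classical
  unfold index rightToLeft leftToRight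
  simp only [Finset.card_filter]
  push_cast
  rw [← Finset.sum_sub_distrib, ← Finset.sum_sub_distrib, ← Finset.sum_add_distrib]
  refine Finset.sum_congr rfl fun d hd => ?_
  by_cases hdc : d = c
  · subst hdc
    simp [chordTerm_self, sbtw_irrefl_left, sbtw_irrefl_right]
  · have hne : ∀ {x y : CirclePoint ι}, x ≠ y → x.2 ≠ y.2 := fun h =>
      snd_ne_of_ne (Subsingleton.elim _ _) h
    have hcc := hne (D.tail_ne_head c hc c hc)
    have e1 := sbtw_iff_not_sbtw_of_ne (hne (D.tail_ne_tail hd hc hdc))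
      (hne (D.tail_ne_head d hd c hc)) hcc
    have e2 := sbtw_iff_not_sbtw_of_ne (hne (D.tail_ne_head c hc d hd).symm)
      (hne (D.head_ne_head hd hc hdc)) hcc
    simp only [chordTerm, arcIndicator, e1, e2]
    by_cases h1 : sbtw c.tail.2 d.tail.2 c.head.2 <;>
      by_cases h2 : sbtw c.tail.2 d.head.2 c.head.2 <;>
      rcases Int.units_eq_one_or d.sign with h3 | h3 <;> simp [h1, h2, h3]

theorem writhe_sublink (D : GaussDiagram ι) (i : ι) (k : ℤ) :
    (D.sublink {i}).writhe k = D.selfWrithe i k := by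
  classical
  have hself : ∀ a : SignedArrow ι,
      (a.tail.1 ∈ ({i} : Finset ι) ∧ a.head.1 ∈ ({i} : Finset ι)) ↔ a.IsSelf i := by
    simp [IsSelf]
  have hidx : ∀ c ∈ (D.sublink {i}).arrows,
      (D.sublink {i}).index c = D.selfIndex i (inclArrow {i} c) := by
    intro c hc
    rw [index_eq_sum _ hc]
    refine (D.sum_sublink {i} (fun d => (inclArrow {i} c).chordTerm d)).trans ?_
    exact Finset.sum_congr rfl fun d _ => if_congr (hself d) rfl rfl
  unfold writhe
  rw [Finset.sum_filter, Finset.sum_congr rfl fun c hc => by rw [hidx c hc]]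
  refine (D.sum_sublink {i} (fun c => if D.selfIndex i c = k then (c.sign : ℤ) else 0)).trans ?_
  unfold selfWrithe
  refine Finset.sum_congr rfl fun c _ => ?_
  rw [if_congr (hself c) rfl rfl, ite_and]

end GaussDiagram

/-! ### Sorting arrows by the components they connect. -/

theorem ite_congr_of_iff {α : Sort*} {p q : Prop} {_ : Decidable p} {_ : Decidable q} {x y : α}
    (h : p ↔ q) : (if p then x else y) = if q then x else y := if_congr h rfl rfl

namespace SignedArrow

variable {ι : Type}

open Classical in
/-- Indicator of the arrows between the circles `i` and `j`. -/
noncomputable def joins (i j : ι) (a : SignedArrow ι) : ℤ :=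
  if (a.tail.1 = i ∧ a.head.1 = j) ∨ (a.tail.1 = j ∧ a.head.1 = i) then 1 else 0

open Classical in
/-- The sign of the arrow if it runs from the circle `i` to the circle `j`. -/
noncomputable def signFromTo (i j : ι) (a : SignedArrow ι) : ℤ :=
  if a.tail.1 = i ∧ a.head.1 = j then (a.sign : ℤ) else 0

open Classical in
/-- Indicator of the self arrows of the circle `i`. -/
noncomputable def selfIndicator (i : ι) (a : SignedArrow ι) : ℤ := if a.IsSelf i then 1 else 0

theorem selfIndicator_nonneg (i : ι) (a : SignedArrow ι) : 0 ≤ a.selfIndicator i := by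
  unfold selfIndicator; split_ifs <;> simp

theorem abs_sign (a : SignedArrow ι) : |(a.sign : ℤ)| = 1 := by
  rcases Int.units_eq_one_or a.sign with h | h <;> simp [h]

theorem abs_signFromTo_add {i j : ι} (hij : i ≠ j) (a : SignedArrow ι) :
    |a.signFromTo i j| + |a.signFromTo j i| = a.joins i j := by
  unfold signFromTo joins
  by_cases h1 : a.tail.1 = i ∧ a.head.1 = j
  · have h2 : ¬ (a.tail.1 = j ∧ a.head.1 = i) := fun h2 => hij (h1.1.symm.trans h2.1)
    rw [if_pos h1, if_neg h2, if_pos (Or.inl h1), abs_sign, abs_zero, add_zero]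
  · by_cases h2 : a.tail.1 = j ∧ a.head.1 = i
    · rw [if_neg h1, if_pos h2, if_pos (Or.inr h2), abs_sign, abs_zero, zero_add]
    · rw [if_neg h1, if_neg h2, if_neg (not_or.2 ⟨h1, h2⟩), abs_zero, zero_add]

/-- An arrow either joins exactly one unordered pair of circles or is a self arrow of exactly one
circle. This lets separate bounds for pairs and components add up to a bound on a number of
crossings. -/
theorem sum_joins_add_sum_selfIndicator [Fintype ι] [LinearOrder ι] (σ : Equiv.Perm ι)
    (a : SignedArrow ι) :
    (∑ p : ι × ι with p.1 < p.2, a.joins (σ p.1) (σ p.2)) + ∑ i, a.selfIndicator (σ i) = 1 := by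
  classical
  obtain ⟨u, hu⟩ := σ.surjective a.tail.1
  obtain ⟨v, hv⟩ := σ.surjective a.head.1
  -- The ordered representative of the pair is `(min u v, max u v)`; for `u = v` it is not among the
  -- summation indices.
  have h1 : ∀ p ∈ Finset.univ.filter (fun p : ι × ι => p.1 < p.2),
      a.joins (σ p.1) (σ p.2) = if (min u v, max u v) = p then 1 else 0 := by
    rintro ⟨i, j⟩ hp
    have hij : i < j := (Finset.mem_filter.1 hp).2
    unfold joins
    rw [← hu, ← hv]
    refine ite_congr_of_iff ?_
    simp only [EmbeddingLike.apply_eq_iff_eq, Prod.mk.injEq]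
    constructor
    · rintro (⟨rfl, rfl⟩ | ⟨rfl, rfl⟩)
      · exact ⟨min_eq_left hij.le, max_eq_right hij.le⟩
      · exact ⟨min_eq_right hij.le, max_eq_left hij.le⟩
    · rintro ⟨rfl, rfl⟩
      rcases le_total u v with h | h
      · simp [h]
      · simp [h]
  have h2 : ∀ i ∈ (Finset.univ : Finset ι),
      a.selfIndicator (σ i) = if u = i then (if u = v then 1 else 0) else 0 := by
    intro i _
    unfold selfIndicator IsSelf
    rw [← hu, ← hv, ← ite_and]
    refine ite_congr_of_iff ?_
    simp only [EmbeddingLike.apply_eq_iff_eq]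
    constructor
    · rintro ⟨rfl, rfl⟩; exact ⟨rfl, rfl⟩
    · rintro ⟨rfl, rfl⟩; exact ⟨rfl, rfl⟩
  rw [Finset.sum_congr rfl h1, Finset.sum_congr rfl h2, Finset.sum_ite_eq, Finset.sum_ite_eq]
  by_cases h : u = v
  · simp [h]
  · simp [h, Ne.symm h]

end SignedArrow

namespace GaussDiagram

open SignedArrow

variable {ι : Type}

/-! ### Virtualization and crossing changes -/

theorem overLk_eq_sum (D : GaussDiagram ι) (i j : ι) :
    D.overLk i j = ∑ a ∈ D.arrows, a.signFromTo i j := rfl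

theorem selfWrithe_virtualize (D : GaussDiagram ι) {S : Finset (SignedArrow ι)} {i : ι}
    (hS : ∀ a ∈ S, ¬ a.IsSelf i) (k : ℤ) :
    (D.virtualize S).selfWrithe i k = D.selfWrithe i k := by
  classical
  have hmem : ∀ a ∈ D.arrows, a ∉ (D.virtualize S).arrows → ¬ a.IsSelf i := fun a ha ha' =>
    hS a (by by_contra h; exact ha' (Finset.mem_sdiff.2 ⟨ha, h⟩))
  have hidx : ∀ c, (D.virtualize S).selfIndex i c = D.selfIndex i c := fun c =>
    Finset.sum_subset Finset.sdiff_subset fun a ha ha' => if_neg (hmem a ha ha')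
  unfold selfWrithe
  simp only [hidx]
  exact Finset.sum_subset Finset.sdiff_subset fun a ha ha' => if_neg fun h => hmem a ha ha' h.1

open Classical in
/-- The effect of changing the crossings in `T` on one arrow. -/
noncomputable def flipIn (T : Finset (SignedArrow ι)) (a : SignedArrow ι) : SignedArrow ι :=
  if a ∈ T then a.flip else a

/-- Since all end points are distinct, changing crossings never merges two arrows. -/
theorem sum_changeCrossings (D : GaussDiagram ι) (T : Finset (SignedArrow ι))
    (f : SignedArrow ι → ℤ) :
    ∑ a ∈ (D.changeCrossings T).arrows, f a = ∑ a ∈ D.arrows, f (flipIn T a) := by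
  have e : (D.changeCrossings T).arrows = D.arrows.image (flipIn T) := by
    unfold changeCrossings flipIn
    refine Finset.image_congr fun a _ => ?_
    by_cases h : a ∈ T
    · simp only [h, if_true]
    · simp only [h, if_false]
  rw [e, Finset.sum_image]
  intro x hx y hy h
  unfold flipIn at h
  split_ifs at h with h1 h2 h2
  · exact D.head_inj x hx y hy (congrArg SignedArrow.tail h)
  · exact absurd (congrArg SignedArrow.tail h).symm (D.tail_ne_head y hy x hx)
  · exact absurd (congrArg SignedArrow.tail h) (D.tail_ne_head x hx y hy)
  · exact h

/-- The correction is symmetric in `i` and `j`, because over and under are exchanged together with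
the sign. Thus crossing changes leave the difference of the two linking numbers alone. -/
theorem overLk_changeCrossings (D : GaussDiagram ι) {T : Finset (SignedArrow ι)}
    (hT : T ⊆ D.arrows) (i j : ι) : (D.changeCrossings T).overLk i j =
      D.overLk i j - ∑ a ∈ T, (a.signFromTo i j + a.signFromTo j i) := by
  classical
  rw [overLk_eq_sum, sum_changeCrossings, overLk_eq_sum, ← Finset.sum_sdiff hT,
    ← Finset.sum_sdiff hT (f := fun a => a.signFromTo i j), add_sub_assoc,
    ← Finset.sum_sub_distrib]
  congr 1
  · refine Finset.sum_congr rfl fun a ha => ?_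
    rw [flipIn, if_neg (Finset.mem_sdiff.1 ha).2]
  · refine Finset.sum_congr rfl fun a ha => ?_
    rw [flipIn, if_pos ha]
    simp only [signFromTo, SignedArrow.flip, Units.val_neg, and_comm (a := a.head.1 = i)]
    split_ifs <;> ring

theorem isSelf_flipIn (T : Finset (SignedArrow ι)) (a : SignedArrow ι) (i : ι) :
    (flipIn T a).IsSelf i ↔ a.IsSelf i := by
  unfold flipIn
  split_ifs
  · exact and_comm
  · rfl

/-- Reversing `d` negates both its sign and the difference of indicators. -/
theorem chordTerm_flipIn_right (T : Finset (SignedArrow ι)) (c d : SignedArrow ι) :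
    c.chordTerm (flipIn T d) = c.chordTerm d := by
  unfold flipIn
  split_ifs
  · simp only [chordTerm, SignedArrow.flip, Units.val_neg]
    ring
  · rfl

/-- Reversing `c` replaces its arc by the complementary one, so each indicator becomes one minus
itself and the difference changes sign. -/
theorem chordTerm_flip_left (D : GaussDiagram ι) {c d : SignedArrow ι} {i : ι}
    (hc : c ∈ D.arrows) (hd : d ∈ D.arrows) (hci : c.IsSelf i) (hdi : d.IsSelf i) :
    c.flip.chordTerm d = -c.chordTerm d := by
  by_cases hdc : d = c
  · subst hdc
    simp [chordTerm, SignedArrow.flip, arcIndicator_self_left, arcIndicator_self_right]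
  · have hcc := snd_ne_of_ne (hci.1.trans hci.2.symm) (D.tail_ne_head c hc c hc)
    have key : ∀ x : CirclePoint ι, x.1 = i → x ≠ c.tail → x ≠ c.head →
        arcIndicator c.head.2 c.tail.2 x.2 = 1 - arcIndicator c.tail.2 c.head.2 x.2 := by
      intro x hx h1 h2
      have := sbtw_iff_not_sbtw_of_ne (snd_ne_of_ne (hx.trans hci.1.symm) h1)
        (snd_ne_of_ne (hx.trans hci.2.symm) h2) hcc
      unfold arcIndicator
      by_cases h : sbtw c.tail.2 x.2 c.head.2 <;> simp [this, h]
    simp only [chordTerm, SignedArrow.flip]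
    rw [key _ hdi.1 (D.tail_ne_tail hd hc hdc) (D.tail_ne_head d hd c hc),
      key _ hdi.2 (D.tail_ne_head c hc d hd).symm (D.head_ne_head hd hc hdc)]
    ring

theorem selfIndex_changeCrossings (D : GaussDiagram ι) (T : Finset (SignedArrow ι)) (i : ι)
    (c : SignedArrow ι) : (D.changeCrossings T).selfIndex i c = D.selfIndex i c := by
  classical
  refine (sum_changeCrossings D T _).trans (Finset.sum_congr rfl fun d _ => ?_)
  rw [chordTerm_flipIn_right]
  exact if_congr (isSelf_flipIn T d i) rfl rfl

theorem selfIndex_flip (D : GaussDiagram ι) {i : ι} {c : SignedArrow ι} (hc : c ∈ D.arrows)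
    (hci : c.IsSelf i) : D.selfIndex i c.flip = -D.selfIndex i c := by
  unfold selfIndex
  rw [← Finset.sum_neg_distrib]
  refine Finset.sum_congr rfl fun d hd => ?_
  split_ifs with hdi
  · exact D.chordTerm_flip_left hc hd hci hdi
  · simp

/-- A changed chord of sign s and index d reappears with sign -s and index -d: the writhe at d loses
s, and the writhe at -d gains -s. -/
theorem selfWrithe_changeCrossings (D : GaussDiagram ι) {T : Finset (SignedArrow ι)}
    (hT : T ⊆ D.arrows) (i : ι) (k : ℤ) : (D.changeCrossings T).selfWrithe i k =
      D.selfWrithe i k - open Classical in ∑ c ∈ T with c.IsSelf i, (c.sign : ℤ) *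
        ((if D.selfIndex i c = k then 1 else 0) + if -D.selfIndex i c = k then 1 else 0) := by
  classical
  unfold selfWrithe
  rw [sum_changeCrossings, ← Finset.sum_sdiff hT,
    ← Finset.sum_sdiff hT (f := fun c => if c.IsSelf i ∧ D.selfIndex i c = k then _ else _),
    add_sub_assoc, Finset.sum_filter, ← Finset.sum_sub_distrib]
  simp only [selfIndex_changeCrossings]
  congr 1
  · refine Finset.sum_congr rfl fun a ha => ?_
    rw [flipIn, if_neg (Finset.mem_sdiff.1 ha).2]
  · refine Finset.sum_congr rfl fun a ha => ?_
    rw [if_congr (and_congr_left_iff.2 fun _ => isSelf_flipIn T a i) rfl rfl, flipIn, if_pos ha]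
    by_cases hai : a.IsSelf i
    · rw [D.selfIndex_flip (hT ha) hai]
      simp only [hai, true_and, if_true, SignedArrow.flip, Units.val_neg]
      split_ifs <;> ring
    · simp [hai]

theorem overLk_unlink (i j : ι) : (unlink ι).overLk i j = 0 := Finset.sum_empty

theorem selfWrithe_unlink (i : ι) (k : ℤ) : (unlink ι).selfWrithe i k = 0 := Finset.sum_empty

/-! ### The lower bound for an unknotting of a diagram. -/

theorem abs_selfWrithe_le (D : GaussDiagram ι) {T : Finset (SignedArrow ι)} (hT : T ⊆ D.arrows)
    {i : ι} {k : ℤ} (h : (D.changeCrossings T).selfWrithe i k = 0) :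
    |D.selfWrithe i k| ≤ open Classical in ∑ c ∈ T with c.IsSelf i,
      ((if D.selfIndex i c = k then 1 else 0) + if -D.selfIndex i c = k then 1 else 0) := by
  rw [selfWrithe_changeCrossings D hT, sub_eq_zero] at h
  rw [h]
  refine (Finset.abs_sum_le_sum_abs _ _).trans (Finset.sum_le_sum fun c _ => ?_)
  rw [abs_mul, abs_sign, one_mul, abs_of_nonneg]
  split_ifs <;> simp

/-- Each `c` is counted only at `k = g c` and at `k = -g c`, hence at most twice in the whole sum.
-/
theorem finsum_abs_le {α : Type*} (T : Finset α) (g : α → ℤ) (f : ℤ → ℤ)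
    (h : ∀ k ≠ 0, |f k| ≤ ∑ c ∈ T, ((if g c = k then 1 else 0) + if -g c = k then 1 else 0)) :
    ∑ᶠ (k : ℤ) (_ : k ≠ 0), |f k| ≤ 2 * T.card := by
  classical
  have hle : ∀ k : ℤ, ∑ᶠ (_ : k ≠ 0), |f k| ≤
      ∑ c ∈ T, ((if g c = k then 1 else 0) + if -g c = k then 1 else 0) := by
    intro k
    rw [finsum_eq_if]
    split_ifs with hk
    · exact h k hk
    · exact Finset.sum_nonneg fun c _ => by split_ifs <;> simp
  have hsupp : (Function.support fun k : ℤ => ∑ᶠ (_ : k ≠ 0), |f k|) ⊆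
      ↑(T.image g ∪ T.image fun c => -g c) := by
    intro k hk
    by_contra hn
    simp only [Finset.coe_union, Finset.coe_image, Set.mem_union, Set.mem_image, not_or,
      not_exists, not_and, Finset.mem_coe] at hn
    refine hk (le_antisymm ((hle k).trans_eq (Finset.sum_eq_zero fun c hc => ?_)) ?_)
    · rw [if_neg (hn.1 c hc), if_neg (hn.2 c hc), add_zero]
    · exact finsum_nonneg fun _ => abs_nonneg _
  rw [finsum_eq_sum_of_support_subset _ hsupp]
  refine (Finset.sum_le_sum fun k _ => hle k).trans ?_
  rw [Finset.sum_comm, mul_comm, ← nsmul_eq_mul]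
  refine Finset.sum_le_card_nsmul _ _ _ fun c _ => ?_
  rw [Finset.sum_add_distrib, Finset.sum_ite_eq, Finset.sum_ite_eq]
  split_ifs <;> simp

/-- Equality in |x - y| ≤ |x| + |y| forces `c` to lie between `r` and `l`, so |c| is at least the
distance of 0 from that interval. -/
theorem ellBound_le_of_sum {r l x y c n : ℤ} (hx : r - x = c) (hy : l - y = c)
    (h : |x| + |y| = n) (h' : |r - l| = n) : ellBound r l ≤ |c| := by
  unfold ellBound
  rcases abs_cases x with h1 | h1 <;> rcases abs_cases y with h2 | h2 <;>
    rcases abs_cases (r - l) with h3 | h3 <;> rcases abs_cases c with h4 | h4 <;> omega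

section

variable [Fintype ι] [LinearOrder ι]

theorem span_eq_sum (D : GaussDiagram ι) :
    (D.span : ℤ) = ∑ p : ι × ι with p.1 < p.2, |D.overLk p.1 p.2 - D.overLk p.2 p.1| := by
  unfold span
  push_cast
  exact Finset.sum_congr rfl fun p _ => by rw [wriggle_eq_overLk_sub]

/-- The arrows of a set, counted by the components that they connect. -/
theorem sum_sum_joins_add (σ : Equiv.Perm ι) (T : Finset (SignedArrow ι)) :
    (∑ p : ι × ι with p.1 < p.2, ∑ a ∈ T, a.joins (σ p.1) (σ p.2)) +
      ∑ i, ∑ a ∈ T, a.selfIndicator (σ i) = T.card := by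
  rw [Finset.sum_comm, Finset.sum_comm (s := Finset.univ), ← Finset.sum_add_distrib,
    Finset.sum_congr rfl fun a _ => sum_joins_add_sum_selfIndicator σ a]
  simp

/-- The lower bound for a diagram `E` that becomes trivial when the crossings in `S` are
virtualized and those in `T` are changed; `σ` is a renumbering of the components. -/
theorem bound_of_unknotting (E : GaussDiagram ι) (σ : Equiv.Perm ι) {S T : Finset (SignedArrow ι)}
    (hS : S ⊆ E.arrows) (hT : T ⊆ E.arrows) (hST : Disjoint S T)
    (h : (setoid ι).r ((E.virtualize S).changeCrossings T) (unlink ι)) :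
    (∑ p : ι × ι with p.1 < p.2,
        |E.overLk (σ p.1) (σ p.2) - E.overLk (σ p.2) (σ p.1)|) ≤ S.card ∧
    ((∑ p : ι × ι with p.1 < p.2,
        |E.overLk (σ p.1) (σ p.2) - E.overLk (σ p.2) (σ p.1)|) = S.card →
      2 * (∑ p : ι × ι with p.1 < p.2,
        ellBound (E.overLk (σ p.1) (σ p.2)) (E.overLk (σ p.2) (σ p.1))) +
      ∑ i, (∑ᶠ (k : ℤ) (_ : k ≠ 0), |E.selfWrithe (σ i) k|) ≤ 2 * T.card) := by
  classical
  have hTF : T ⊆ (E.virtualize S).arrows := fun a ha =>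
    Finset.mem_sdiff.2 ⟨hT ha, fun hs => Finset.disjoint_left.1 hST hs ha⟩
  obtain ⟨ρ, hρ1, hρ2⟩ := (sameInvariants_of_equiv h).symm
  have hlk : ∀ i j, i ≠ j → ((E.virtualize S).changeCrossings T).overLk i j = 0 := by
    intro i j hij
    have := hρ1 (ρ.symm i) (ρ.symm j) (fun e => hij (ρ.symm.injective e))
    rwa [ρ.apply_symm_apply, ρ.apply_symm_apply, overLk_unlink] at this
  have hwr : ∀ i k, k ≠ 0 → ((E.virtualize S).changeCrossings T).selfWrithe i k = 0 := by
    intro i k hk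
    have := hρ2 (ρ.symm i) k hk
    rwa [ρ.apply_symm_apply, selfWrithe_unlink] at this
  -- linking numbers after virtualization
  have hV : ∀ i j, i ≠ j → E.overLk i j - ∑ a ∈ S, a.signFromTo i j =
      ∑ a ∈ T, (a.signFromTo i j + a.signFromTo j i) := by
    intro i j hij
    have h1 := hlk i j hij
    rw [overLk_changeCrossings _ hTF, sub_eq_zero, overLk_virtualize _ hS] at h1
    exact h1
  have hV' : ∀ i j, i ≠ j → E.overLk j i - ∑ a ∈ S, a.signFromTo j i =
      ∑ a ∈ T, (a.signFromTo i j + a.signFromTo j i) := by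
    intro i j hij
    rw [hV j i hij.symm]
    exact Finset.sum_congr rfl fun a _ => add_comm _ _
  have hsumS : ∀ i j, i ≠ j →
      |∑ a ∈ S, a.signFromTo i j| + |∑ a ∈ S, a.signFromTo j i| ≤ ∑ a ∈ S, a.joins i j := by
    intro i j hij
    rw [Finset.sum_congr rfl fun a _ => (abs_signFromTo_add hij a).symm, Finset.sum_add_distrib]
    exact add_le_add (Finset.abs_sum_le_sum_abs _ _) (Finset.abs_sum_le_sum_abs _ _)
  -- The contribution of `T` is the same for both orders of the pair and drops out of the
  -- difference.
  have hdiff : ∀ i j, i ≠ j → |E.overLk i j - E.overLk j i| ≤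
      |∑ a ∈ S, a.signFromTo i j| + |∑ a ∈ S, a.signFromTo j i| := by
    intro i j hij
    have e : E.overLk i j - E.overLk j i =
        ∑ a ∈ S, a.signFromTo i j - ∑ a ∈ S, a.signFromTo j i := by
      linarith [hV i j hij, hV' i j hij]
    rw [e]
    exact abs_sub _ _
  have hne : ∀ p ∈ Finset.univ.filter (fun p : ι × ι => p.1 < p.2), σ p.1 ≠ σ p.2 := fun p hp e =>
    (Finset.mem_filter.1 hp).2.ne (σ.injective e)
  have hle : ∀ p ∈ Finset.univ.filter (fun p : ι × ι => p.1 < p.2),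
      |E.overLk (σ p.1) (σ p.2) - E.overLk (σ p.2) (σ p.1)| ≤
        ∑ a ∈ S, a.joins (σ p.1) (σ p.2) := fun p hp =>
    (hdiff _ _ (hne p hp)).trans (hsumS _ _ (hne p hp))
  have hcountS := sum_sum_joins_add σ S
  have hself : 0 ≤ ∑ i, ∑ a ∈ S, a.selfIndicator (σ i) :=
    Finset.sum_nonneg fun i _ => Finset.sum_nonneg fun a _ => a.selfIndicator_nonneg _
  have hsum := Finset.sum_le_sum hle
  refine ⟨by linarith, fun heq => ?_⟩
  -- Equality of the totals forces equality for every pair, and also leaves no room for self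
  -- crossings in `S`.
  have heq' := (Finset.sum_eq_sum_iff_of_le hle).1 (le_antisymm hsum (by linarith))
  -- no self crossing is virtualized
  have hS0 : ∀ i, ∀ a ∈ S, ¬ a.IsSelf (σ i) := by
    intro i a ha hai
    have h0 : ∑ i, ∑ a ∈ S, a.selfIndicator (σ i) = 0 := by linarith
    rw [Finset.sum_eq_zero_iff_of_nonneg
      (fun i _ => Finset.sum_nonneg fun a _ => a.selfIndicator_nonneg _)] at h0
    have h1 := (Finset.sum_eq_zero_iff_of_nonneg
      (fun a _ => a.selfIndicator_nonneg _)).1 (h0 i (Finset.mem_univ _)) a ha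
    rw [selfIndicator, if_pos hai] at h1
    exact one_ne_zero h1
  have hell : ∀ p ∈ Finset.univ.filter (fun p : ι × ι => p.1 < p.2),
      ellBound (E.overLk (σ p.1) (σ p.2)) (E.overLk (σ p.2) (σ p.1)) ≤
        ∑ a ∈ T, a.joins (σ p.1) (σ p.2) := by
    intro p hp
    have hij := hne p hp
    -- The sum of absolute values is squeezed between the difference of linking numbers and the
    -- number of virtualized crossings of the pair, which agree by `heq'`.
    refine (ellBound_le_of_sum (hV _ _ hij) (hV' _ _ hij) (le_antisymm (hsumS _ _ hij) ?_)
      (heq' p hp)).trans ?_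
    · rw [← heq' p hp]
      exact hdiff _ _ hij
    · refine (Finset.abs_sum_le_sum_abs _ _).trans (Finset.sum_le_sum fun a _ => ?_)
      rw [← abs_signFromTo_add hij]
      exact abs_add_le _ _
  have hwrithe : ∀ i ∈ (Finset.univ : Finset ι),
      ∑ᶠ (k : ℤ) (_ : k ≠ 0), |E.selfWrithe (σ i) k| ≤ 2 * ∑ a ∈ T, a.selfIndicator (σ i) := by
    intro i _
    have e : ∑ a ∈ T, a.selfIndicator (σ i) = (T.filter fun a => a.IsSelf (σ i)).card := by
      unfold selfIndicator
      rw [Finset.card_filter]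
      push_cast
      rfl
    rw [e]
    refine finsum_abs_le _ (fun c => (E.virtualize S).selfIndex (σ i) c) _ fun k hk => ?_
    rw [← selfWrithe_virtualize E (hS0 i)]
    exact abs_selfWrithe_le _ hTF (hwr _ k hk)
  have h1 := Finset.sum_le_sum hell
  have h2 := Finset.sum_le_sum hwrithe
  rw [← Finset.mul_sum] at h2
  have h3 := sum_sum_joins_add σ T
  linarith

end

end GaussDiagram

/-! ### Comparison of a given diagram with an optimal one. -/

theorem theorem2p5 {n : ℕ} (L : VirtualLink n) (D : GaussDiagram (Fin n))
    (hD : VirtualLink.IsDiagram D L) :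
    (toLex ((D.span : ℚ),
        (∑ p : Fin n × Fin n with p.1 < p.2, (D.sublink {p.1, p.2}).ell) +
          (1 / 2) * ∑ i : Fin n,
            ((∑ᶠ (k : ℤ) (_ : k ≠ 0), |(D.sublink {i}).writhe k| : ℤ) : ℚ)) : ℚ ×ₗ ℚ) ≤
      toLex (((ofLex L.unknottingIndex).1 : ℚ), ((ofLex L.unknottingIndex).2 : ℚ)) := by
  -- `E` is a diagram of `L` at which the minimum defining the unknotting index is attained.
  obtain ⟨E, hE, hEL⟩ := (wellFounded_lt (α := ℕ ×ₗ ℕ)).min_mem _ L.diagrams_nonempty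
  have hEU : L.unknottingIndex ∈ E.unknottingPairs := by
    have : L.unknottingIndex = E.unknottingIndex := hEL.symm
    rw [this]
    exact (wellFounded_lt (α := ℕ ×ₗ ℕ)).min_mem _ E.unknottingPairs_nonempty
  obtain ⟨S, T, hS, hT, hST, hSc, hTc, h⟩ := hEU
  have hDE : (GaussDiagram.setoid (Fin n)).r D E :=
    Quotient.exact (s := GaussDiagram.setoid (Fin n)) (hD.trans hE.symm)
  obtain ⟨σ, h1, h2⟩ := GaussDiagram.sameInvariants_of_equiv hDE
  obtain ⟨hle, heq⟩ := E.bound_of_unknotting σ hS hT hST h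
  have hspan : (D.span : ℤ) = ∑ p : Fin n × Fin n with p.1 < p.2,
      |E.overLk (σ p.1) (σ p.2) - E.overLk (σ p.2) (σ p.1)| := by
    rw [D.span_eq_sum]
    refine Finset.sum_congr rfl fun p hp => ?_
    have hp' := (Finset.mem_filter.1 hp).2.ne
    rw [h1 _ _ hp', h1 _ _ hp'.symm]
  rw [← hspan] at hle heq
  rw [hSc] at hle heq
  rw [hTc] at heq
  rw [Prod.Lex.toLex_le_toLex]
  -- A strict inequality in the first coordinate settles the dictionary order; otherwise the
  -- equality case of the bound applies.
  rcases (Nat.cast_le.1 hle).lt_or_eq with hlt | hsp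
  · exact Or.inl (Nat.cast_lt.2 hlt)
  · refine Or.inr ⟨congrArg Nat.cast hsp, ?_⟩
    have hfin := heq (by exact_mod_cast hsp)
    -- `ell` is not itself shown to be invariant; its upper bound `ellBound` is expressed in linking
    -- numbers and can be carried over to `E`.
    have hell : ∑ p : Fin n × Fin n with p.1 < p.2, (D.sublink {p.1, p.2}).ell ≤
        ((∑ p : Fin n × Fin n with p.1 < p.2, GaussDiagram.ellBound
          (E.overLk (σ p.1) (σ p.2)) (E.overLk (σ p.2) (σ p.1)) : ℤ) : ℚ) := by
      rw [Int.cast_sum]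
      refine Finset.sum_le_sum fun p hp => ?_
      have hp' := (Finset.mem_filter.1 hp).2
      rw [h1 _ _ hp'.ne, h1 _ _ hp'.ne']
      exact D.ell_sublink_le hp'
    have hwr : ∀ i, ∑ᶠ (k : ℤ) (_ : k ≠ 0), |(D.sublink {i}).writhe k| =
        ∑ᶠ (k : ℤ) (_ : k ≠ 0), |E.selfWrithe (σ i) k| := fun i =>
      finsum_congr fun k => finsum_congr fun hk => by rw [D.writhe_sublink, h2 i k hk]
    simp only [hwr]
    rw [← Int.cast_sum]
    have hfin' : (2 : ℚ) * ((∑ p : Fin n × Fin n with p.1 < p.2, GaussDiagram.ellBound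
          (E.overLk (σ p.1) (σ p.2)) (E.overLk (σ p.2) (σ p.1)) : ℤ) : ℚ) +
        ((∑ i, ∑ᶠ (k : ℤ) (_ : k ≠ 0), |E.selfWrithe (σ i) k| : ℤ) : ℚ) ≤
        2 * ((ofLex L.unknottingIndex).2 : ℚ) := by
      exact_mod_cast hfin
    linarith
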